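/- Let $\mathbf F$ be an algebraically closed field of characteristic $p>3$ and let $\Gamma$ be an abelian group with a bicharacter $(\,,):\Gamma\times\Gamma\to\mathbf F^\times$, i.e. $(\alpha,\beta)(\beta,\alpha)=1$, $(\alpha,\beta+\gamma)=(\alpha,\beta)(\alpha,\gamma)$ and $(\alpha+\beta,\gamma)=(\alpha,\gamma)(\beta,\gamma)$; put $\Gamma^+=\{\alpha\in\Gamma : (\alpha,\alpha)=1\}$. A Lie color algebra is a $\Gamma$-graded $\mathbf F$-vector space $\mathfrak g=\bigoplus_{\alpha\in\Gamma}\mathfrak g_\alpha$ with a bilinear bracket such that $[\mathfrak g_\alpha,\mathfrak g_\beta]\subseteq\mathfrak g_{\alpha+\beta}$, $[y,x]=-(\beta,\alpha)[x,y]$ and $$(\gamma,\alpha)[x,[y,z]]+(\alpha,\beta)[y,[z,x]]+(\beta,\gamma)[z,[x,y]]=0$$ for $x\in\mathfrak g_\alpha$, $y\in\mathfrak g_\beta$, $z\in\mathfrak g_\gamma$. It is restricted if it is equipped, for every $\alpha\in\Gamma^+$, with a map $x\mapsto x^{[p]}$, $\mathfrak g_\alpha\to\mathfrak g_{p\alpha}$,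 such that for $x,y\in\mathfrak g_\alpha$ and $r\in\mathbf F$: $(x+y)^{[p]}=x^{[p]}+y^{[p]}+\sum_{i=1}^{p-1}s_i(x,y)$, where $i\,s_i(x,y)$ is the coefficient of $t^{i-1}$ in $(\mathrm{ad}(tx+y))^{p-1}(x)\in\mathfrak g[t]$; $(rx)^{[p]}=r^px^{[p]}$; and $\mathrm{ad}\,x^{[p]}=(\mathrm{ad}\,x)^p$ on $\mathfrak g$. For $\alpha\in\Gamma^+$ with $p\alpha\neq0$ of finite order $s$, let $\mathscr F_\alpha$ be the set of equivalence classes $[\xi,c]$ of pairs $(\xi,c)$ with $\xi\in\mathfrak g_\alpha$, $c\in\mathfrak g_\alpha^*$, $c(\xi)=1$, where $(\xi,c)\sim(\eta,b)$ means $c=c(\eta)b$, $b=b(\xi)c$ and $c(\eta)^s=b(\xi)^s=1$. A $p$-character of $\mathfrak g$ is a family $\chi=\{\chi_\alpha\}_{\alpha\in\Gamma^+}$ such that $\chi_\alpha\in\mathfrak g_\alpha^*$ if $p\alpha=0$; $\chi_\alpha=0$ if $\alpha$ has infinite order; and $\chi_\alpha\in\mathscr F_\alpha\cup\{0\}$ if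 $p\alpha\ne0$ has finite order. Let $U(\mathfrak g)$ be the universal enveloping algebra, i.e. the quotient of the tensor algebra of $\mathfrak g$ by the two-sided ideal generated by the elements $x\otimes y-(\alpha,\beta)y\otimes x-[x,y]$ with $x\in\mathfrak g_\alpha$, $y\in\mathfrak g_\beta$, $\alpha,\beta\in\Gamma$. The $\chi$-reduced enveloping algebra is the $\Gamma$-graded algebra $u_\chi(\mathfrak g)=U(\mathfrak g)/I_\chi$, where $I_\chi$ is the two-sided ideal generated, for $\alpha\in\Gamma^+$ and $x\in\mathfrak g_\alpha$, by $x^p-x^{[p]}-\chi_\alpha(x)^p\cdot1$ if $\chi_\alpha$ is a linear form (possibly $0$), and by $(\xi^p-\xi^{[p]})^s-1$ (where $s$ is the order of $p\alpha$) and $(x^p-x^{[p]})-c(x)^p(\xi^p-\xi^{[p]})$ if $\chi_\alpha=[\xi,c]\in\mathscr F_\alpha$ (this does not depend on the representative $(\xi,c)$). **Theorem 2.17.** Let $\mathfrak g$ be a finite-dimensional restricted Lie color algebra over $\mathbf F$ and let $\chi$ be a $p$-character of $\mathfrak g$. Then $u_\chi(\mathfrak g)$ is a Frobenius algebra: there is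 a nondegenerate bilinear form $f$ on $u_\chi(\mathfrak g)$ that is invariant, i.e. $f(xy,z)=f(x,yz)$ for all homogeneous $x,y,z\in u_\chi(\mathfrak g)$. -/

import Mathlib

open scoped DirectSum

noncomputable section

universe u v w

namespace LieColor

/-! ### Bicharacters -/

/-- A (skew-symmetric) bicharacter `(,) : Γ × Γ → Fˣ` on an abelian group `Γ`. -/
structure Bicharacter (Γ : Type w) (F : Type u) [AddCommGroup Γ] [Field F] where
  toFun : Γ → Γ → Fˣ
  mul_swap : ∀ α β, toFun α β * toFun β α = 1
  add_right : ∀ α β γ, toFun α (β + γ) = toFun α β * toFun α γ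
  add_left : ∀ α β γ, toFun (α + β) γ = toFun α γ * toFun β γ

instance {Γ : Type w} {F : Type u} [AddCommGroup Γ] [Field F] :
    CoeFun (Bicharacter Γ F) (fun _ => Γ → Γ → Fˣ) := ⟨Bicharacter.toFun⟩

/-- `α ∈ Γ⁺`, that is `(α, α) = 1`. -/
def Bicharacter.IsEven {Γ : Type w} {F : Type u} [AddCommGroup Γ] [Field F]
    (ε : Bicharacter Γ F) (α : Γ) : Prop := ε α α = 1

section Main

variable {Γ : Type w} {F : Type u} [AddCommGroup Γ] [DecidableEq Γ] [Field F]

/-! ### Restricted Lie color algebras -/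

/-- A structure of Lie color algebra on the vector space `𝔤`: a grading `𝔤 = ⨁ 𝔤_α` by `Γ` and a
bilinear bracket which is homogeneous, color skew-symmetric and satisfies the color Jacobi
identity. -/
structure LieColorAlgebra (ε : Bicharacter Γ F) (𝔤 : Type v) [AddCommGroup 𝔤] [Module F 𝔤] where
  grade : Γ → Submodule F 𝔤
  isInternal : DirectSum.IsInternal grade
  bracket : 𝔤 →ₗ[F] 𝔤 →ₗ[F] 𝔤
  bracket_mem : ∀ {α β : Γ} {x y : 𝔤}, x ∈ grade α → y ∈ grade β →
    bracket x y ∈ grade (α + β)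
  skew : ∀ {α β : Γ} {x y : 𝔤}, x ∈ grade α → y ∈ grade β →
    bracket y x = -((ε β α : F) • bracket x y)
  jacobi : ∀ {α β γ : Γ} {x y z : 𝔤}, x ∈ grade α → y ∈ grade β → z ∈ grade γ →
    (ε γ α : F) • bracket x (bracket y z) + (ε α β : F) • bracket y (bracket z x)
      + (ε β γ : F) • bracket z (bracket x y) = 0

/-- The operator `ad (t x + y)` on `𝔤[t]`, where the bracket of `𝔤` is extended `F[t]`-linearly. -/
def LieColorAlgebra.adPoly {ε : Bicharacter Γ F} {𝔤 : Type v} [AddCommGroup 𝔤] [Module F 𝔤]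
    (L : LieColorAlgebra ε 𝔤) (x y : 𝔤) (q : PolynomialModule F 𝔤) : PolynomialModule F 𝔤 :=
  (Polynomial.X : Polynomial F) • PolynomialModule.map F (L.bracket x) q
    + PolynomialModule.map F (L.bracket y) q

/-- The element `s_i(x, y)`: `i s_i(x, y)` is the coefficient of `t ^ (i - 1)` in
`(ad (t x + y)) ^ (p - 1) (x) ∈ 𝔤[t]`. It is used for `1 ≤ i ≤ p - 1` only, in characteristic
`p`. -/
def LieColorAlgebra.s {ε : Bicharacter Γ F} {𝔤 : Type v} [AddCommGroup 𝔤] [Module F 𝔤]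
    (L : LieColorAlgebra ε 𝔤) (p i : ℕ) (x y : 𝔤) : 𝔤 :=
  (i : F)⁻¹ • ((L.adPoly x y)^[p - 1] (PolynomialModule.single F 0 x)).coeff (i - 1)

/-- A structure of restricted Lie color algebra on `𝔤`: a Lie color algebra with `p`-maps
`x ↦ x^[p]`, `𝔤_α → 𝔤_{pα}`, for all `α ∈ Γ⁺`. -/
structure RestrictedLieColorAlgebra (p : ℕ) (ε : Bicharacter Γ F) (𝔤 : Type v)
    [AddCommGroup 𝔤] [Module F 𝔤] extends LieColorAlgebra ε 𝔤 where
  pMap : ∀ α : Γ, ε.IsEven α → grade α → grade (p • α)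
  pMap_add : ∀ (α : Γ) (hα : ε.IsEven α) (x y : grade α),
    (pMap α hα (x + y) : 𝔤) = pMap α hα x + pMap α hα y
      + ∑ i ∈ Finset.Icc 1 (p - 1), toLieColorAlgebra.s p i (x : 𝔤) (y : 𝔤)
  pMap_smul : ∀ (α : Γ) (hα : ε.IsEven α) (r : F) (x : grade α),
    pMap α hα (r • x) = r ^ p • pMap α hα x
  ad_pMap : ∀ (α : Γ) (hα : ε.IsEven α) (x : grade α) (z : 𝔤),
    bracket (pMap α hα x : 𝔤) z = (fun y => bracket (x : 𝔤) y)^[p] z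

variable {p : ℕ} {ε : Bicharacter Γ F} {𝔤 : Type v} [AddCommGroup 𝔤] [Module F 𝔤]

/-! ### The universal enveloping algebra -/

/-- The relations `x ⊗ y - (α, β) y ⊗ x = [x, y]`, for `x ∈ 𝔤_α`, `y ∈ 𝔤_β`, in the tensor
algebra. -/
inductive LieColorAlgebra.EnvRel (L : LieColorAlgebra ε 𝔤) :
    TensorAlgebra F 𝔤 → TensorAlgebra F 𝔤 → Prop
  | mk {α β : Γ} (x : L.grade α) (y : L.grade β) :
    LieColorAlgebra.EnvRel L
      (TensorAlgebra.ι F (x : 𝔤) * TensorAlgebra.ι F (y : 𝔤)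
        - (ε α β : F) • (TensorAlgebra.ι F (y : 𝔤) * TensorAlgebra.ι F (x : 𝔤)))
      (TensorAlgebra.ι F (L.bracket x y))

/-- The universal enveloping algebra `U(𝔤)`. -/
def LieColorAlgebra.Env (L : LieColorAlgebra ε 𝔤) : Type _ := RingQuot L.EnvRel

instance (L : LieColorAlgebra ε 𝔤) : Ring L.Env := inferInstanceAs (Ring (RingQuot L.EnvRel))

instance (L : LieColorAlgebra ε 𝔤) : Algebra F L.Env :=
  inferInstanceAs (Algebra F (RingQuot L.EnvRel))

/-- The quotient map `T(𝔤) → U(𝔤)`. -/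
def LieColorAlgebra.envMk (L : LieColorAlgebra ε 𝔤) : TensorAlgebra F 𝔤 →ₐ[F] L.Env :=
  RingQuot.mkAlgHom F L.EnvRel

/-- The canonical map `𝔤 → U(𝔤)`. -/
def LieColorAlgebra.envι (L : LieColorAlgebra ε 𝔤) : 𝔤 →ₗ[F] L.Env :=
  L.envMk.toLinearMap ∘ₗ TensorAlgebra.ι F

/-! ### `p`-characters -/

/-- The pairs `(ξ, c)` with `ξ ∈ 𝔤_α`, `c ∈ 𝔤_α^*` and `c(ξ) = 1`. -/
def LieColorAlgebra.CharPair (L : LieColorAlgebra ε 𝔤) (α : Γ) : Type _ :=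
  {q : L.grade α × Module.Dual F (L.grade α) // q.2 q.1 = 1}

/-- The equivalence relation `(ξ, c) ∼ (η, b)` if and only if `c = c(η) b`, `b = b(ξ) c` and
`c(η)^s = b(ξ)^s = 1`, where `s` is the order of `pα`. -/
def LieColorAlgebra.charSetoid (p : ℕ) (L : LieColorAlgebra ε 𝔤) (α : Γ) :
    Setoid (L.CharPair α) where
  r q q' := q.1.2 = q.1.2 q'.1.1 • q'.1.2 ∧ q'.1.2 = q'.1.2 q.1.1 • q.1.2 ∧
    q.1.2 q'.1.1 ^ addOrderOf (p • α) = 1 ∧ q'.1.2 q.1.1 ^ addOrderOf (p • α) = 1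
  iseqv := by
    refine ⟨?_, ?_, ?_⟩
    · intro q
      simp [q.2]
    · rintro q q' ⟨h1, h2, h3, h4⟩
      exact ⟨h2, h1, h4, h3⟩
    · rintro ⟨⟨ξ, c⟩, h1⟩ ⟨⟨η, b⟩, h2⟩ ⟨⟨ζ, d⟩, h3⟩ ⟨e1, e2, e3, e4⟩ ⟨f1, f2, f3, f4⟩
      simp only at *
      have hc : c ζ = c η * b ζ := by
        have := congrArg (fun l => l ζ) e1
        simpa using this
      have hd : d ξ = d η * b ξ := by
        have := congrArg (fun l => l ξ) f2
        simpa using this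
      refine ⟨?_, ?_, ?_, ?_⟩
      · rw [hc, mul_smul, ← f1, ← e1]
      · rw [hd, mul_smul, ← e2, ← f2]
      · rw [hc, mul_pow, e3, f3, one_mul]
      · rw [hd, mul_pow, f4, e4, one_mul]

/-- The set `𝓕_α` of the equivalence classes `[ξ, c]`. -/
def LieColorAlgebra.CharClass (p : ℕ) (L : LieColorAlgebra ε 𝔤) (α : Γ) : Type _ :=
  Quotient (L.charSetoid p α)

/-- A `p`-character of `𝔤`: a family `χ_α`, `α ∈ Γ⁺`, where `χ_α` is a linear form on `𝔤_α`
if `pα = 0`, is `0` if `α` has infinite order, and is `0` or an element of `𝓕_α` if `pα ≠ 0` has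
finite order. -/
structure PCharacter (L : RestrictedLieColorAlgebra p ε 𝔤) where
  toFun : ∀ α : Γ, ε.IsEven α → Module.Dual F (L.grade α) ⊕ L.CharClass p α
  of_smul_eq_zero : ∀ (α : Γ) (hα : ε.IsEven α), p • α = 0 → ∃ l, toFun α hα = Sum.inl l
  of_infinite : ∀ (α : Γ) (hα : ε.IsEven α), ¬ IsOfFinAddOrder α → toFun α hα = Sum.inl 0
  of_finite : ∀ (α : Γ) (hα : ε.IsEven α), p • α ≠ 0 → IsOfFinAddOrder (p • α) →
    toFun α hα = Sum.inl 0 ∨ ∃ q, toFun α hα = Sum.inr q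

/-! ### The reduced enveloping algebra -/

/-- The element `x^p - x^[p]` of `U(𝔤)`, for `x ∈ 𝔤_α`, `α ∈ Γ⁺`. -/
def RestrictedLieColorAlgebra.pDiff (L : RestrictedLieColorAlgebra p ε 𝔤) (α : Γ)
    (hα : ε.IsEven α) (x : L.grade α) : L.Env :=
  L.envι (x : 𝔤) ^ p - L.envι (L.pMap α hα x : 𝔤)

/-- The relations that define the reduced enveloping algebra as a quotient of `U(𝔤)`. For a class
`χ_α = [ξ, c]` they are imposed for all its representatives `(ξ, c)`; any one of them would
do. -/
inductive PCharacter.RedRel {L : RestrictedLieColorAlgebra p ε 𝔤} (χ : PCharacter L) :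
    L.Env → L.Env → Prop
  | linear {α : Γ} {hα : ε.IsEven α} {l : Module.Dual F (L.grade α)}
      (h : χ.toFun α hα = Sum.inl l) (x : L.grade α) :
      PCharacter.RedRel χ (L.pDiff α hα x) (algebraMap F L.Env (l x ^ p))
  | root {α : Γ} {hα : ε.IsEven α} {q : L.CharPair α}
      (h : χ.toFun α hα = Sum.inr (Quotient.mk (L.charSetoid p α) q)) :
      PCharacter.RedRel χ (L.pDiff α hα q.1.1 ^ addOrderOf (p • α)) 1
  | proportional {α : Γ} {hα : ε.IsEven α} {q : L.CharPair α}
      (h : χ.toFun α hα = Sum.inr (Quotient.mk (L.charSetoid p α) q)) (x : L.grade α) :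
      PCharacter.RedRel χ (L.pDiff α hα x) ((q.1.2 x ^ p) • L.pDiff α hα q.1.1)

/-- The `χ`-reduced enveloping algebra `u_χ(𝔤) = U(𝔤) / I_χ`. -/
def PCharacter.RedEnv {L : RestrictedLieColorAlgebra p ε 𝔤} (χ : PCharacter L) : Type _ :=
  RingQuot χ.RedRel

instance {L : RestrictedLieColorAlgebra p ε 𝔤} (χ : PCharacter L) : Ring χ.RedEnv :=
  inferInstanceAs (Ring (RingQuot χ.RedRel))

instance {L : RestrictedLieColorAlgebra p ε 𝔤} (χ : PCharacter L) : Algebra F χ.RedEnv :=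
  inferInstanceAs (Algebra F (RingQuot χ.RedRel))

/-- The quotient map `U(𝔤) → u_χ(𝔤)`. -/
def PCharacter.quot {L : RestrictedLieColorAlgebra p ε 𝔤} (χ : PCharacter L) :
    L.Env →ₐ[F] χ.RedEnv :=
  RingQuot.mkAlgHom F χ.RedRel

/-- The canonical map `σ : 𝔤 → u_χ(𝔤)`. -/
def PCharacter.σ {L : RestrictedLieColorAlgebra p ε 𝔤} (χ : PCharacter L) :
    𝔤 →ₗ[F] χ.RedEnv :=
  χ.quot.toLinearMap ∘ₗ L.envι

/-- The component of degree `γ` of `u_χ(𝔤)`: the span of the products `σ(x₁) ⋯ σ(x_k)` of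
homogeneous elements of `𝔤` whose degrees have the sum `γ`. -/
def PCharacter.grade {L : RestrictedLieColorAlgebra p ε 𝔤} (χ : PCharacter L) (γ : Γ) :
    Submodule F χ.RedEnv :=
  Submodule.span F {a | ∃ l : List (Σ α : Γ, L.grade α),
    (l.map Sigma.fst).sum = γ ∧ (l.map fun x => χ.σ (x.2 : 𝔤)).prod = a}

/-! ### The grading of the reduced enveloping algebra -/

section Grading

variable {L : RestrictedLieColorAlgebra p ε 𝔤} (χ : PCharacter L)

instance PCharacter.gradedMonoid : SetLike.GradedMonoid χ.grade where
  one_mem := Submodule.subset_span ⟨[], by simp, by simp⟩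
  mul_mem γ δ a b ha hb := by
    have h : χ.grade γ * χ.grade δ ≤ χ.grade (γ + δ) := by
      rw [PCharacter.grade, PCharacter.grade, Submodule.span_mul_span, Submodule.span_le]
      rintro _ ⟨_, ⟨l, hl, rfl⟩, _, ⟨m, hm, rfl⟩, rfl⟩
      exact Submodule.subset_span ⟨l ++ m, by simp [hl, hm], by simp⟩
    exact h (Submodule.mul_mem_mul ha hb)

lemma PCharacter.σ_mem {α : Γ} (x : L.grade α) : χ.σ (x : 𝔤) ∈ χ.grade α :=
  Submodule.subset_span ⟨[⟨α, x⟩], by simp, by simp⟩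

/-- `X` is the homogeneous element `a` of degree `γ`, in the external direct sum. -/
def PCharacter.IsOf (X : ⨁ γ, χ.grade γ) (γ : Γ) (a : χ.RedEnv) : Prop :=
  ∃ h : a ∈ χ.grade γ, X = DirectSum.of (fun γ => χ.grade γ) γ ⟨a, h⟩

variable {χ}

lemma PCharacter.IsOf.eq {X Y : ⨁ γ, χ.grade γ} {γ δ : Γ} {a b : χ.RedEnv}
    (hX : χ.IsOf X γ a) (hY : χ.IsOf Y δ b) (h : γ = δ) (h' : a = b) : X = Y := by
  subst h h'
  obtain ⟨_, rfl⟩ := hX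
  obtain ⟨_, rfl⟩ := hY
  rfl

lemma PCharacter.IsOf.mul {X Y : ⨁ γ, χ.grade γ} {γ δ : Γ} {a b : χ.RedEnv}
    (hX : χ.IsOf X γ a) (hY : χ.IsOf Y δ b) : χ.IsOf (X * Y) (γ + δ) (a * b) := by
  obtain ⟨h, rfl⟩ := hX
  obtain ⟨h', rfl⟩ := hY
  exact ⟨SetLike.GradedMul.mul_mem h h', by rw [DirectSum.of_mul_of]; rfl⟩

lemma PCharacter.IsOf.one : χ.IsOf 1 0 1 :=
  ⟨SetLike.GradedOne.one_mem, rfl⟩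

lemma PCharacter.IsOf.pow {X : ⨁ γ, χ.grade γ} {γ : Γ} {a : χ.RedEnv}
    (hX : χ.IsOf X γ a) (n : ℕ) : χ.IsOf (X ^ n) (n • γ) (a ^ n) := by
  induction n with
  | zero => simpa using PCharacter.IsOf.one
  | succ n ih => simpa only [pow_succ, succ_nsmul] using ih.mul hX

lemma PCharacter.IsOf.add {X Y : ⨁ γ, χ.grade γ} {γ : Γ} {a b : χ.RedEnv}
    (hX : χ.IsOf X γ a) (hY : χ.IsOf Y γ b) : χ.IsOf (X + Y) γ (a + b) := by
  obtain ⟨h, rfl⟩ := hX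
  obtain ⟨h', rfl⟩ := hY
  exact ⟨add_mem h h', by rw [← map_add]; rfl⟩

lemma PCharacter.IsOf.smul {X : ⨁ γ, χ.grade γ} {γ : Γ} {a : χ.RedEnv}
    (hX : χ.IsOf X γ a) (r : F) : χ.IsOf (r • X) γ (r • a) := by
  obtain ⟨h, rfl⟩ := hX
  exact ⟨Submodule.smul_mem _ r h, by rw [← DirectSum.of_smul]; rfl⟩

lemma PCharacter.IsOf.sub {X Y : ⨁ γ, χ.grade γ} {γ : Γ} {a b : χ.RedEnv}
    (hX : χ.IsOf X γ a) (hY : χ.IsOf Y γ b) : χ.IsOf (X - Y) γ (a - b) := by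
  have h1 : X - Y = X + (-1 : F) • Y := by module
  have h2 : a - b = a + (-1 : F) • b := by module
  rw [h1, h2]
  exact hX.add (hY.smul _)

lemma PCharacter.IsOf.zero (γ : Γ) : χ.IsOf 0 γ 0 :=
  ⟨zero_mem _, (map_zero (DirectSum.of (fun γ => χ.grade γ) γ)).symm⟩

variable (χ)

/-- The map `x ↦ ∑ σ(x_α)` from `𝔤` to the external direct sum of the components of `u_χ(𝔤)`. -/
def PCharacter.decι : 𝔤 →ₗ[F] ⨁ γ, χ.grade γ :=
  DirectSum.lmap (fun α => (χ.σ ∘ₗ (L.grade α).subtype).codRestrict (χ.grade α) χ.σ_mem) ∘ₗ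
    (LinearEquiv.ofBijective (DirectSum.coeLinearMap L.grade) L.isInternal).symm.toLinearMap

lemma PCharacter.decι_isOf {α : Γ} (x : L.grade α) :
    χ.IsOf (χ.decι (x : 𝔤)) α (χ.σ (x : 𝔤)) := by
  refine ⟨χ.σ_mem x, ?_⟩
  have h : (LinearEquiv.ofBijective (DirectSum.coeLinearMap L.grade) L.isInternal).symm (x : 𝔤)
      = DirectSum.of (fun α => L.grade α) α x := by
    rw [LinearEquiv.symm_apply_eq]
    exact (DirectSum.coeLinearMap_of L.grade α x).symm
  simp only [PCharacter.decι, LinearMap.comp_apply, LinearEquiv.coe_coe, h, DirectSum.lmap_of]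
  rfl

lemma PCharacter.env_comm {α β : Γ} (x : L.grade α) (y : L.grade β) :
    L.envι (x : 𝔤) * L.envι (y : 𝔤) - (ε α β : F) • (L.envι (y : 𝔤) * L.envι (x : 𝔤))
      = L.envι (L.bracket x y) := by
  have h : L.envMk _ = L.envMk _ :=
    RingQuot.mkAlgHom_rel F (LieColorAlgebra.EnvRel.mk (L := L.toLieColorAlgebra) x y)
  rw [map_sub, map_smul, map_mul, map_mul] at h
  exact h

lemma PCharacter.quot_rel {a b : L.Env} (h : χ.RedRel a b) : χ.quot a = χ.quot b :=
  RingQuot.mkAlgHom_rel F h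

/-- The algebra homomorphism from `T(𝔤)` to the external direct sum. -/
def PCharacter.decTensor : TensorAlgebra F 𝔤 →ₐ[F] ⨁ γ, χ.grade γ :=
  TensorAlgebra.lift F χ.decι

lemma PCharacter.decTensor_rel {a b : TensorAlgebra F 𝔤} (h : L.EnvRel a b) :
    χ.decTensor a = χ.decTensor b := by
  obtain ⟨x, y⟩ := h
  rename_i α β
  rw [map_sub, map_smul, map_mul, map_mul]
  simp only [PCharacter.decTensor, TensorAlgebra.lift_ι_apply]
  have hx := χ.decι_isOf x
  have hy := χ.decι_isOf y
  have hxy := χ.decι_isOf ⟨L.bracket x y, L.bracket_mem x.2 y.2⟩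
  have hyx := (hy.mul hx).smul (ε α β : F)
  rw [add_comm β α] at hyx
  refine ((hx.mul hy).sub hyx).eq hxy rfl ?_
  have := congrArg χ.quot (PCharacter.env_comm x y)
  rw [map_sub, map_smul, map_mul, map_mul] at this
  exact this

/-- The algebra homomorphism from `U(𝔤)` to the external direct sum. -/
def PCharacter.decEnv : L.Env →ₐ[F] ⨁ γ, χ.grade γ :=
  RingQuot.liftAlgHom F ⟨χ.decTensor, fun _ _ h => χ.decTensor_rel h⟩

lemma PCharacter.decEnv_envι (x : 𝔤) : χ.decEnv (L.envι x) = χ.decι x := by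
  refine (RingQuot.liftAlgHom_mkAlgHom_apply F χ.decTensor
    (fun _ _ h => χ.decTensor_rel h) _).trans ?_
  exact TensorAlgebra.lift_ι_apply _ _

lemma PCharacter.decEnv_pDiff {α : Γ} (hα : ε.IsEven α) (x : L.grade α) :
    χ.IsOf (χ.decEnv (L.pDiff α hα x)) (p • α) (χ.quot (L.pDiff α hα x)) := by
  simp only [RestrictedLieColorAlgebra.pDiff, map_sub, map_pow, PCharacter.decEnv_envι]
  exact ((χ.decι_isOf x).pow p).sub (χ.decι_isOf (L.pMap α hα x))

lemma PCharacter.decEnv_rel {a b : L.Env} (hab : χ.RedRel a b) :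
    χ.decEnv a = χ.decEnv b := by
  have hrel := χ.quot_rel hab
  induction hab with
  | @linear α hα l h x =>
    have h1 := χ.decEnv_pDiff hα x
    by_cases h0 : p • α = 0
    · have h2 : χ.IsOf (χ.decEnv (algebraMap F L.Env (l x ^ p))) 0
          (χ.quot (algebraMap F L.Env (l x ^ p))) := by
        rw [Algebra.algebraMap_eq_smul_one, map_smul, map_smul, map_one, map_one]
        exact PCharacter.IsOf.one.smul _
      exact h1.eq h2 h0 hrel
    · have hp : p ≠ 0 := fun hp => h0 (by rw [hp, zero_smul])
      have hl : l = 0 := by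
        by_cases hf : IsOfFinAddOrder (p • α)
        · rcases χ.of_finite α hα h0 hf with h' | ⟨q, h'⟩ <;> rw [h] at h'
          · exact Sum.inl.inj h'
          · cases h'
        · have h' := χ.of_infinite α hα (fun hh => hf hh.nsmul)
          rw [h] at h'
          exact Sum.inl.inj h'
      subst hl
      have hz : algebraMap F L.Env ((0 : Module.Dual F (L.grade α)) x ^ p) = 0 := by
        rw [LinearMap.zero_apply, zero_pow hp, map_zero]
      rw [hz] at hrel ⊢
      rw [map_zero] at hrel ⊢
      exact h1.eq (PCharacter.IsOf.zero _) rfl hrel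
  | @root α hα q h =>
    have h1 := (χ.decEnv_pDiff hα q.1.1).pow (addOrderOf (p • α))
    rw [← map_pow, ← map_pow] at h1
    rw [map_one] at hrel ⊢
    exact h1.eq PCharacter.IsOf.one (addOrderOf_nsmul_eq_zero _) hrel
  | @proportional α hα q h x =>
    have h1 := χ.decEnv_pDiff hα x
    have h2 := (χ.decEnv_pDiff hα q.1.1).smul (q.1.2 x ^ p)
    rw [← map_smul, ← map_smul] at h2
    exact h1.eq h2 rfl hrel

/-- The algebra homomorphism from `u_χ(𝔤)` to the external direct sum of its components. -/
def PCharacter.dec : χ.RedEnv →ₐ[F] ⨁ γ, χ.grade γ :=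
  RingQuot.liftAlgHom F ⟨χ.decEnv, fun _ _ h => χ.decEnv_rel h⟩

lemma PCharacter.dec_σ (x : 𝔤) : χ.dec (χ.σ x) = χ.decι x :=
  (RingQuot.liftAlgHom_mkAlgHom_apply F χ.decEnv (fun _ _ h => χ.decEnv_rel h) _).trans
    (χ.decEnv_envι x)

lemma PCharacter.dec_word (l : List (Σ α : Γ, L.grade α)) :
    χ.IsOf (χ.dec (l.map fun x => χ.σ (x.2 : 𝔤)).prod) (l.map Sigma.fst).sum
      (l.map fun x => χ.σ (x.2 : 𝔤)).prod := by
  induction l with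
  | nil => simpa using PCharacter.IsOf.one
  | cons x l ih =>
    simp only [List.map_cons, List.prod_cons, List.sum_cons, map_mul, PCharacter.dec_σ]
    exact (χ.decι_isOf x.2).mul ih

lemma PCharacter.dec_of_mem {γ : Γ} {a : χ.RedEnv} (ha : a ∈ χ.grade γ) :
    χ.IsOf (χ.dec a) γ a := by
  unfold PCharacter.grade at ha
  induction ha using Submodule.span_induction with
  | mem a h =>
    obtain ⟨l, rfl, rfl⟩ := h
    exact χ.dec_word l
  | zero => rw [map_zero]; exact PCharacter.IsOf.zero γ
  | add a b _ _ iha ihb => rw [map_add]; exact iha.add ihb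
  | smul r a _ iha => rw [map_smul]; exact iha.smul r

lemma PCharacter.coe_decι (x : 𝔤) :
    DirectSum.coeAlgHom χ.grade (χ.decι x) = χ.σ x := by
  obtain ⟨X, rfl⟩ := L.isInternal.2 x
  induction X using DirectSum.induction_on with
  | zero => simp
  | of α y =>
    have : DirectSum.coeAddMonoidHom L.grade (DirectSum.of (fun α => L.grade α) α y) = (y : 𝔤) :=
      DirectSum.coeAddMonoidHom_of _ _ _
    rw [this]
    obtain ⟨h, h'⟩ := χ.decι_isOf y
    rw [h', DirectSum.coeAlgHom_of]
  | add X Y hX hY => simp only [map_add, hX, hY]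

/-- The algebra `u_χ(𝔤)` is `Γ`-graded. -/
instance PCharacter.gradedAlgebra : GradedAlgebra χ.grade :=
  GradedAlgebra.ofAlgHom χ.grade χ.dec
    (by
      refine RingQuot.ringQuot_ext' (S := F) (s := χ.RedRel) _ _
        (RingQuot.ringQuot_ext' (S := F) (s := L.EnvRel) _ _
        (TensorAlgebra.hom_ext (LinearMap.ext fun x => ?_)))
      change DirectSum.coeAlgHom χ.grade (χ.dec (χ.σ x)) = χ.σ x
      rw [PCharacter.dec_σ, PCharacter.coe_decι])
    (by
      rintro γ ⟨a, ha⟩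
      obtain ⟨_, h⟩ := χ.dec_of_mem ha
      exact h)

end Grading

end Main

/-! ### Frobenius algebras -/

section Frobenius

variable {Γ : Type w} {F : Type u} [AddCommGroup Γ] [DecidableEq Γ] [Field F]
  {A : Type v} [Ring A] [Algebra F A]

/-- A bilinear form `f` on a `Γ`-graded algebra is invariant if `f(xy, z) = f(x, yz)` for all
homogeneous `x`, `y`, `z`. -/
def IsInvariant (𝒜 : Γ → Submodule F A) [GradedAlgebra 𝒜] (f : LinearMap.BilinForm F A) : Prop :=
  ∀ (α β γ : Γ) (x y z : A), x ∈ 𝒜 α → y ∈ 𝒜 β → z ∈ 𝒜 γ → f (x * y) z = f x (y * z)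

/-- An associative `Γ`-graded algebra is Frobenius if it has a nondegenerate invariant bilinear
form. -/
def IsFrobenius (𝒜 : Γ → Submodule F A) [GradedAlgebra 𝒜] : Prop :=
  ∃ f : LinearMap.BilinForm F A, f.Nondegenerate ∧ IsInvariant 𝒜 f

end Frobenius

end LieColor

end

/-! ### The diamond lemma and quotient rings. -/

noncomputable section

open Module

/-! The form is f(a, b) = Λ(ab) for a linear functional Λ on u_χ(𝔤). Invariance is then
associativity, and everything rests on finding a Λ whose kernel contains no nonzero left or right
ideal.

Choose a homogeneous basis x_i of 𝔤 adapted to χ. To each even index belongs an element h_i of U(𝔤)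
with leading term x_i^N_i, and these generate the kernel of U(𝔤) → u_χ(𝔤) (`quot_eq_zero_iff`): h_i
is x_i^p - x_i^[p], possibly minus a constant, or (ξ^p - ξ^[p])^s - 1. The axiom ad x^[p] = (ad x)^p
makes x^p - x^[p] commute with homogeneous elements up to values of the bicharacter. The constants
do no harm, because a nonzero constant is only subtracted from an element of degree 0. For odd i put
N_i = 2; there x_i² is already a combination of shorter words.

By the Poincaré–Birkhoff–Witt theorem the monomials ∏ h_i^a_i ∏ x_i^r_i with r_i < N_i, and a_i = 0
for odd i, form a basis of U(𝔤). The commutation rules show that the kernel is spanned by those with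
some a_i > 0. So the coordinate at ∏ x_i^(N_i - 1) vanishes on the kernel
(`topCoord_eq_zero_of_mem`) and descends to Λ. For a nonzero combination of monomials with all a_i =
0, multiply by the monomial complementary to a term of highest degree. A comparison of leading words
shows that this term alone contributes to Λ, on either side (`exists_topCoord_mul_ne_zero`).

The Poincaré–Birkhoff–Witt theorem (`linearIndependent_envWord`) comes from the diamond lemma. The
overlaps of the rules resolve by the color Jacobi identity (`rho_overlap`); the overlap xxx of an
odd letter requires 3 to be invertible. -/

/-- The diamond lemma for a family `r` of vectors with leading basis elements `b (w i)`. -/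
theorem eq_zero_of_mem_span_irreducible {F V W I : Type*} [Field F] [AddCommGroup V] [Module F V]
    (lt : W → W → Prop) [IsTrans W lt] (hwf : WellFounded lt) (b : Basis W F V)
    (w : I → W) (r : I → V)
    (hlead : ∀ i, r i - b (w i) ∈ Submodule.span F (b '' {u | lt u (w i)}))
    (hconf : ∀ i j, w i = w j → r i - r j ∈ Submodule.span F (r '' {k | lt (w k) (w i)}))
    {v : V} (hv : v ∈ Submodule.span F (Set.range r))
    (hirr : v ∈ Submodule.span F (b '' {u | ∀ i, w i ≠ u})) : v = 0 := by
  classical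
  have hirrefl : ∀ a, ¬ lt a a := fun a => hwf.irrefl.irrefl a
  -- choose one relation for each reducible word
  let S : Set W := Set.range w
  choose c hc using fun u : S => u.2
  -- Two relations with the same leading word differ by relations with lower leading words, so
  -- well-founded induction expresses every relation by the chosen ones.
  have hspan : ∀ u, ∀ i, w i = u → r i ∈ Submodule.span F (Set.range fun s : S => r (c s)) := by
    intro u
    induction u using hwf.induction with
    | _ u ih =>
      intro i hi
      have h1 := hconf i (c ⟨w i, i, rfl⟩) (hc ⟨w i, i, rfl⟩).symm
      have h2 : r i - r (c ⟨w i, i, rfl⟩) ∈ Submodule.span F (Set.range fun s : S => r (c s)) := by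
        refine Submodule.span_le.2 ?_ h1
        rintro _ ⟨k, hk, rfl⟩
        exact ih (w k) (hi ▸ hk) k rfl
      have := add_mem h2 (Submodule.subset_span (s := Set.range fun s : S => r (c s))
        ⟨⟨w i, i, rfl⟩, rfl⟩)
      simpa using this
  have hv' : v ∈ Submodule.span F (Set.range fun s : S => r (c s)) := by
    refine Submodule.span_le.2 ?_ hv
    rintro _ ⟨i, rfl⟩
    exact hspan _ i rfl
  obtain ⟨f, rfl⟩ := (Finsupp.mem_span_range_iff_exists_finsupp).1 hv'
  by_contra hne
  have hf : f.support.Nonempty := by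
    rw [Finset.nonempty_iff_ne_empty]
    intro h
    rw [Finsupp.support_eq_empty] at h
    exact hne (by simp [h])
  have hcoef : ∀ (u : W) (x : V) (T : Set W), x ∈ Submodule.span F (b '' T) → u ∉ T →
      b.repr x u = 0 := by
    intro u x T hx hu
    have := (b.mem_span_image (m := x)).1 hx
    by_contra h
    exact hu (this (Finsupp.mem_support_iff.2 h))
  -- The order need not be total, so `m` is only maximal. That suffices: the basis vector at `m`
  -- occurs in no other chosen relation of the support, neither as leading term nor in the tail.
  obtain ⟨m, hm, hmax⟩ : ∃ m ∈ f.support, ∀ s ∈ f.support, ¬ lt m.1 s.1 := by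
    let R : S → S → Prop := fun a b => lt b.1 a.1
    have hfin : (f.support : Set S).Finite := f.support.finite_toSet
    have : IsTrans S R := ⟨fun _ _ _ hab hbc => IsTrans.trans (r := lt) _ _ _ hbc hab⟩
    have : Std.Irrefl R := ⟨fun a => hirrefl _⟩
    have : IsStrictOrder S R := {}
    obtain ⟨m, -, h⟩ := (hfin.wellFoundedOn (r := R)).has_min Set.univ
      ⟨⟨hf.choose, hf.choose_spec⟩, trivial⟩
    exact ⟨m.1, m.2, fun s hs hlt => h ⟨s, hs⟩ trivial hlt⟩
  have h0 : b.repr (f.sum fun i a => a • r (c i)) m.1 = 0 := by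
    refine hcoef _ _ _ hirr ?_
    intro h
    exact h (c m) (hc m)
  rw [Finsupp.sum, map_sum, Finsupp.finsetSum_apply, Finset.sum_eq_single m] at h0
  · have h1 : b.repr (r (c m)) m.1 = 1 := by
      have := hcoef m.1 _ _ (hlead (c m)) (by rw [hc m]; exact hirrefl _)
      rw [hc m, map_sub, Finsupp.sub_apply, b.repr_self, Finsupp.single_eq_same, sub_eq_zero] at this
      exact this
    rw [map_smul, Finsupp.smul_apply, h1, smul_eq_mul, mul_one] at h0
    exact (Finsupp.mem_support_iff.1 hm) h0
  · intro s hs hsm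
    have := hcoef m.1 _ _ (hlead (c s)) (by rw [hc s]; exact hmax s hs)
    rw [hc s, map_sub, Finsupp.sub_apply, b.repr_self,
      Finsupp.single_eq_of_ne (fun h => hsm (Subtype.ext h.symm)), sub_zero] at this
    rw [map_smul, Finsupp.smul_apply, this, smul_zero]
  · exact fun h => absurd hm h

/-- An element that dies in a quotient ring lies in every two-sided ideal that contains the
relations. -/
theorem RingQuot.mem_of_mkAlgHom_eq_zero {F A : Type*} [CommRing F] [Ring A] [Algebra F A]
    {rel : A → A → Prop} (J : Ideal A) [J.IsTwoSided] (h : ∀ a b, rel a b → a - b ∈ J) {x : A}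
    (hx : RingQuot.mkAlgHom F rel x = 0) : x ∈ J := by
  let f : A →ₐ[F] A ⧸ J := Ideal.Quotient.mkₐ F J
  have hf : ∀ ⦃a b⦄, rel a b → f a = f b := fun a b hab => Ideal.Quotient.eq.2 (h a b hab)
  have h1 : f x = RingQuot.liftAlgHom F ⟨f, hf⟩ (RingQuot.mkAlgHom F rel x) :=
    (RingQuot.liftAlgHom_mkAlgHom_apply F f hf x).symm
  rw [hx, map_zero] at h1
  exact Ideal.Quotient.eq_zero_iff_mem.1 h1

namespace LieColor

/-! ### An order on words -/

/-- The weight `∑ (number of letters after a) * a` of a word. -/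
def wordWeight {n : ℕ} : List (Fin n) → ℕ
  | [] => 0
  | a :: w => a * w.length + wordWeight w

/-- Words are compared by length, and by weight if they have the same length and letter sum. -/
def WordLT {n : ℕ} (u v : List (Fin n)) : Prop :=
  u.length < v.length ∨ (u.length = v.length ∧
    (u.map Fin.val).sum = (v.map Fin.val).sum ∧ wordWeight u < wordWeight v)

lemma wordWeight_append {n : ℕ} (u v : List (Fin n)) :
    wordWeight (u ++ v) = (u.map Fin.val).sum * v.length + wordWeight u + wordWeight v := by
  induction u with
  | nil => simp [wordWeight]
  | cons a u ih => simp only [List.cons_append, wordWeight, ih, List.length_append, List.map_cons,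
      List.sum_cons]; ring

instance {n : ℕ} : IsTrans (List (Fin n)) WordLT where
  trans u v w h h' := by unfold WordLT at *; omega

lemma WordLT.wf {n : ℕ} : WellFounded (WordLT (n := n)) := by
  refine Subrelation.wf (r := InvImage (Prod.Lex (· < ·) (· < ·))
    fun w : List (Fin n) => (w.length, wordWeight w)) ?_
    (InvImage.wf _ (WellFounded.prod_lex wellFounded_lt wellFounded_lt))
  rintro u v (h | ⟨h, -, h'⟩)
  · exact Prod.Lex.left _ _ h
  · simp only [InvImage, h]
    exact Prod.Lex.right _ h'

/-- The weight of `A ++ u ++ B` depends on `u` through its length, letter sum and weight. This is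
why the order compares weights only for equal letter sums. -/
lemma WordLT.context {n : ℕ} {u v : List (Fin n)} (h : WordLT u v) (A B : List (Fin n)) :
    WordLT (A ++ u ++ B) (A ++ v ++ B) := by
  unfold WordLT at *
  simp only [wordWeight_append, List.length_append, List.map_append, List.sum_append]
  rcases h with h | ⟨h, h', h''⟩
  · left; omega
  · right; rw [h, h']; omega

section PBW

variable {Γ : Type*} {F : Type*} [AddCommGroup Γ] [Field F]
  {ε : Bicharacter Γ F} {𝔤 : Type*} [AddCommGroup 𝔤] [Module F 𝔤]

/-! ### Bicharacters -/

lemma Bicharacter.coe_mul_swap (ε : Bicharacter Γ F) (α β : Γ) : (ε α β : F) * ε β α = 1 := by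
  rw [← Units.val_mul, ε.mul_swap, Units.val_one]

lemma Bicharacter.coe_add_right (ε : Bicharacter Γ F) (α β γ : Γ) :
    (ε α (β + γ) : F) = ε α β * ε α γ := by
  rw [ε.add_right, Units.val_mul]

lemma Bicharacter.coe_add_left (ε : Bicharacter Γ F) (α β γ : Γ) :
    (ε (α + β) γ : F) = ε α γ * ε β γ := by
  rw [ε.add_left, Units.val_mul]

lemma Bicharacter.coe_self_of_not_isEven (ε : Bicharacter Γ F) {α : Γ} (h : ¬ ε.IsEven α) :
    (ε α α : F) = -1 := by
  rcases mul_self_eq_one_iff.1 (ε.coe_mul_swap α α) with h' | h'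
  · exact absurd (Units.ext h') h
  · exact h'

variable [DecidableEq Γ]

/-! ### The defining relations and their overlap identity. -/

namespace LieColorAlgebra

variable (L : LieColorAlgebra ε 𝔤)

/-- The cyclic identity multiplied by `ε α γ`, with the brackets turned by skew symmetry. These are
the three double brackets left over when the product `x y z` is reordered in two ways. -/
lemma jacobi' {α β γ : Γ} {x y z : 𝔤} (hx : x ∈ L.grade α) (hy : y ∈ L.grade β)
    (hz : z ∈ L.grade γ) :
    L.bracket x (L.bracket y z) - L.bracket (L.bracket x y) z
      + (ε β γ : F) • L.bracket (L.bracket x z) y = 0 := by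
  have h := L.jacobi hx hy hz
  rw [L.skew hx hz, map_neg, map_smul, L.skew (L.bracket_mem hx hz) hy,
    L.skew (L.bracket_mem hx hy) hz, ε.coe_add_right, ε.coe_add_right] at h
  have h1 := ε.coe_mul_swap α β
  have h2 := ε.coe_mul_swap α γ
  have h3 := ε.coe_mul_swap β γ
  have e1 : (ε α γ : F) * (ε α β * (ε γ α * (ε β α * ε β γ))) = ε β γ := by
    linear_combination (ε β γ : F) * (ε α γ * ε γ α * h1 + h2)
  have e2 : (ε α γ : F) * (ε β γ * (ε γ α * ε γ β)) = 1 := by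
    linear_combination ε α γ * ε γ α * h3 + h2
  have h' := congrArg (fun v => (ε α γ : F) • v) h
  simp only [smul_add, smul_neg, neg_neg, smul_smul, smul_zero, h2, one_smul, e1, e2] at h'
  rw [← h']
  abel

/-- The element `xy - c yx - [x, y]` of the tensor algebra. -/
def rho (c : F) (x y : 𝔤) : TensorAlgebra F 𝔤 :=
  TensorAlgebra.ι F x * TensorAlgebra.ι F y - c • (TensorAlgebra.ι F y * TensorAlgebra.ι F x)
    - TensorAlgebra.ι F (L.bracket x y)

/-- Up to a scalar there is one relation for each unordered pair of letters, so rules are needed for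
descents and repeated odd letters only. -/
lemma rho_swap {α β : Γ} {x y : 𝔤} (hx : x ∈ L.grade α) (hy : y ∈ L.grade β) :
    L.rho (ε β α) y x = -((ε β α : F) • L.rho (ε α β) x y) := by
  have h := ε.coe_mul_swap β α
  simp only [rho, L.skew hx hy, smul_sub, smul_smul, h, map_neg, map_smul, one_smul]
  abel

lemma bracket_self (h2 : (2 : F) ≠ 0) {α : Γ} (hα : ε.IsEven α) {x : 𝔤} (hx : x ∈ L.grade α) :
    L.bracket x x = 0 := by
  have h := L.skew hx hx
  rw [show ε α α = 1 from hα, Units.val_one, one_smul, eq_neg_iff_add_eq_zero, ← two_smul F] at h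
  exact (smul_eq_zero.1 h).resolve_left h2

lemma rho_self (h2 : (2 : F) ≠ 0) {α : Γ} (hα : ε.IsEven α) {x : 𝔤} (hx : x ∈ L.grade α) :
    L.rho (ε α α) x x = 0 := by
  simp [rho, L.bracket_self h2 hα hx, show ε α α = 1 from hα]

/-- The two ways of reordering `x y z` agree modulo relations that sit in lower words. The cubic and
quadratic terms cancel formally, and the remaining linear terms are the image of the Jacobi
identity. Letters may coincide, so overlaps with repeated odd letters are special cases. -/
lemma rho_overlap {α β γ : Γ} {x y z : 𝔤} (hx : x ∈ L.grade α) (hy : y ∈ L.grade β)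
    (hz : z ∈ L.grade γ) :
    L.rho (ε α β) x y * TensorAlgebra.ι F z - TensorAlgebra.ι F x * L.rho (ε β γ) y z =
      -((ε α β : F) • (TensorAlgebra.ι F y * L.rho (ε α γ) x z))
      - ((ε α β : F) * ε α γ) • (L.rho (ε β γ) y z * TensorAlgebra.ι F x)
      + (ε β γ : F) • (L.rho (ε α γ) x z * TensorAlgebra.ι F y)
      + ((ε β γ : F) * ε α γ) • (TensorAlgebra.ι F z * L.rho (ε α β) x y)
      + L.rho (ε α (β + γ)) x (L.bracket y z) - L.rho (ε (α + β) γ) (L.bracket x y) z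
      + (ε β γ : F) • L.rho (ε (α + γ) β) (L.bracket x z) y := by
  have hj := congrArg (TensorAlgebra.ι F) (L.jacobi' hx hy hz)
  simp only [map_add, map_sub, map_smul, map_zero] at hj
  have e : (ε β γ : F) * (ε α β * ε γ β) = ε α β := by
    linear_combination (ε α β : F) * ε.coe_mul_swap β γ
  simp only [rho, ε.coe_add_right, ε.coe_add_left, mul_sub, sub_mul, smul_sub, mul_smul_comm,
    smul_mul_assoc, smul_smul, mul_assoc, e]
  linear_combination (norm := module) hj

end LieColorAlgebra
end PBW

section PBW

variable {Γ : Type*} {F : Type*} [AddCommGroup Γ] [DecidableEq Γ] [Field F]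
  {ε : Bicharacter Γ F} {𝔤 : Type*} [AddCommGroup 𝔤] [Module F 𝔤]

/-! ### Words in a homogeneous basis and the rewriting rules of the enveloping algebra -/

section Words

variable {n : ℕ} (e : Basis (Fin n) F 𝔤)

/-- The product of the basis elements that correspond to the letters of a word. -/
def tensorWord (w : List (Fin n)) : TensorAlgebra F 𝔤 :=
  (w.map fun i => TensorAlgebra.ι F (e i)).prod

lemma tensorWord_append (u v : List (Fin n)) :
    tensorWord e (u ++ v) = tensorWord e u * tensorWord e v := by
  simp [tensorWord]

lemma tensorWord_cons (a : Fin n) (v : List (Fin n)) :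
    tensorWord e (a :: v) = TensorAlgebra.ι F (e a) * tensorWord e v := by
  simp [tensorWord]

lemma tensorWord_singleton (a : Fin n) :
    tensorWord e [a] = TensorAlgebra.ι F (e a) := by
  simp [tensorWord]

lemma tensorWord_nil : tensorWord e [] = 1 := by
  simp [tensorWord]

/-- The basis of the tensor algebra that consists of the words in a basis. -/
def wordBasis : Basis (List (Fin n)) F (TensorAlgebra F 𝔤) :=
  e.tensorAlgebra.reindex FreeMonoid.toList

lemma wordBasis_apply (w : List (Fin n)) : wordBasis e w = tensorWord e w := by
  have h : ∀ w : FreeMonoid (Fin n), e.tensorAlgebra w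
      = FreeMonoid.lift (fun i => TensorAlgebra.ι F (e i)) w := by
    intro w
    rw [← e.tensorAlgebra.repr.injective.eq_iff, Basis.repr_self,
      Basis.tensorAlgebra_repr_apply, eq_comm, ← LinearEquiv.eq_symm_apply]
    have h1 : ∀ w : FreeMonoid (Fin n), TensorAlgebra.equivFreeAlgebra e
        (FreeMonoid.lift (fun i => TensorAlgebra.ι F (e i)) w)
        = FreeMonoid.lift (FreeAlgebra.ι F) w := by
      intro w
      induction w using FreeMonoid.recOn with
      | one => simp
      | of_mul x xs hx => simp [hx]
    rw [h1]
    simp [FreeAlgebra.basisFreeMonoid, FreeAlgebra.equivMonoidAlgebraFreeMonoid]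
  rw [wordBasis, Basis.reindex_apply, h, FreeMonoid.lift_apply]
  rfl

lemma range_tensorWord_span : Submodule.span F (Set.range (tensorWord e)) = ⊤ := by
  rw [← (wordBasis e).span_eq]
  congr 2
  ext w
  rw [wordBasis_apply]

end Words

variable (ε) {n : ℕ} (d : Fin n → Γ)

/-- The two-letter word `j i` is reducible. -/
def Redex (j i : Fin n) : Prop := i < j ∨ (i = j ∧ ¬ ε.IsEven (d j))

/-- The positions of the reducible pairs `j i` in words `A j i B`. -/
structure RuleIndex where
  pre : List (Fin n)
  fst : Fin n
  snd : Fin n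
  suf : List (Fin n)
  redex : Redex ε d fst snd

variable {ε d}

/-- The word `A j i B`. -/
def RuleIndex.word (q : RuleIndex ε d) : List (Fin n) := q.pre ++ [q.fst, q.snd] ++ q.suf

variable (L : LieColorAlgebra ε 𝔤) (e : Basis (Fin n) F 𝔤)

namespace LieColorAlgebra

variable (d) in
/-- The element `ρ(e_j, e_i)`, normalized so that the word `j i` has the coefficient `1`. -/
def rule (j i : Fin n) : TensorAlgebra F 𝔤 :=
  (if i = j then (2 : F)⁻¹ else 1) • L.rho (ε (d j) (d i)) (e j) (e i)

/-- The element of the ideal of relations with the leading word `A j i B`. -/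
def ruleAt (q : RuleIndex ε d) : TensorAlgebra F 𝔤 :=
  tensorWord e q.pre * L.rule d e q.fst q.snd * tensorWord e q.suf

variable (d) in
/-- The span of the relations with a leading word lower than `w`. -/
def lowRel (w : List (Fin n)) : Submodule F (TensorAlgebra F 𝔤) :=
  Submodule.span F (L.ruleAt e '' {q : RuleIndex ε d | WordLT q.word w})

variable {L e} (h2 : (2 : F) ≠ 0) (he : ∀ i, e i ∈ L.grade (d i))

/-- The part of `x` along basis vectors of other degrees lies both in the component of degree α and
in the sum of the other components, hence is zero. -/
lemma span_grade (he : ∀ i, e i ∈ L.grade (d i)) {α : Γ} {x : 𝔤} (hx : x ∈ L.grade α) :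
    x ∈ Submodule.span F (e '' {i | d i = α}) := by
  rw [Basis.mem_span_image]
  intro i hi
  by_contra h
  have hind := L.isInternal.submodule_iSupIndep
  -- the components of `x` along the other degrees vanish
  let y : 𝔤 := ∑ j ∈ Finset.univ.filter (fun j => d j = α), e.repr x j • e j
  let z : 𝔤 := ∑ j ∈ Finset.univ.filter (fun j => d j ≠ α), e.repr x j • e j
  have hxyz : y + z = x := by
    have := Finset.sum_filter_add_sum_filter_not Finset.univ (fun j => d j = α)
      (fun j => e.repr x j • e j)
    rwa [e.sum_repr] at this
  have hy : y ∈ L.grade α := Submodule.sum_mem _ fun j hj => by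
    rw [Finset.mem_filter] at hj
    exact Submodule.smul_mem _ _ (hj.2 ▸ he j)
  have hz : z ∈ ⨆ (β) (_ : β ≠ α), L.grade β := Submodule.sum_mem _ fun j hj => by
    rw [Finset.mem_filter] at hj
    exact Submodule.smul_mem _ _
      (Submodule.mem_iSup_of_mem (d j) (Submodule.mem_iSup_of_mem hj.2 (he j)))
  have hz' : z ∈ L.grade α := by
    rw [show z = x - y by rw [← hxyz]; abel]
    exact sub_mem hx hy
  have h0 : z = 0 := Submodule.disjoint_def.1 (hind α) z hz' hz
  have h1 := congrArg (fun v => e.repr v i) h0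
  simp only [z, map_sum, map_smul, Basis.repr_self, Finsupp.finsetSum_apply, Finsupp.smul_apply,
    map_zero, Finsupp.zero_apply] at h1
  rw [Finset.sum_eq_single i] at h1
  · simp at h1
    exact (Finsupp.mem_support_iff.1 hi) h1
  · intro j _ hj
    rw [Finsupp.single_eq_of_ne hj.symm, smul_zero]
  · intro hi'
    exact absurd (Finset.mem_filter.2 ⟨Finset.mem_univ i, h⟩) hi'

include h2 he

/-- Relations between two basis elements are multiples of the rules. -/
lemma mul_rho_mul_mem_lowRel {A B w : List (Fin n)} {a b : Fin n}
    (h1 : WordLT (A ++ [a, b] ++ B) w) (h1' : WordLT (A ++ [b, a] ++ B) w) :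
    tensorWord e A * L.rho (ε (d a) (d b)) (e a) (e b) * tensorWord e B ∈ L.lowRel d e w := by
  have key : ∀ (j i : Fin n) (h : Redex ε d j i), WordLT (A ++ [j, i] ++ B) w →
      tensorWord e A * L.rho (ε (d j) (d i)) (e j) (e i) * tensorWord e B ∈ L.lowRel d e w := by
    intro j i h hlt
    have hm : L.ruleAt e ⟨A, j, i, B, h⟩ ∈ L.lowRel d e w :=
      Submodule.subset_span ⟨_, hlt, rfl⟩
    have hc : (if i = j then (2 : F)⁻¹ else 1) ≠ 0 := by
      split_ifs
      · exact inv_ne_zero h2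
      · exact one_ne_zero
    refine (Submodule.smul_mem_iff _ hc).1 ?_
    simpa only [ruleAt, rule, mul_smul_comm, smul_mul_assoc] using hm
  rcases lt_trichotomy a b with h | h | h
  · rw [L.rho_swap (he b) (he a), mul_neg, neg_mul, mul_smul_comm, smul_mul_assoc]
    exact neg_mem (Submodule.smul_mem _ _ (key b a (Or.inl h) h1'))
  · subst h
    by_cases hev : ε.IsEven (d a)
    · rw [L.rho_self h2 hev (he a), mul_zero, zero_mul]
      exact zero_mem _
    · exact key a a (Or.inr ⟨rfl, hev⟩) h1
  · exact key a b (Or.inl h) h1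

/-- Relations of low degree are combinations of rules with a low leading word. -/
lemma mul_rho_mul_mem_lowRel_of_length {A B w : List (Fin n)} {α β : Γ} {x y : 𝔤}
    (hx : x ∈ L.grade α) (hy : y ∈ L.grade β) (h : A.length + B.length + 2 < w.length) :
    tensorWord e A * L.rho (ε α β) x y * tensorWord e B ∈ L.lowRel d e w := by
  have hx' := span_grade he hx
  have hy' := span_grade he hy
  -- With the scalar frozen at `ε α β` the relation is bilinear in `x` and `y`, which reduces the
  -- claim to basis vectors of degrees α and β.
  let φ : 𝔤 →ₗ[F] 𝔤 →ₗ[F] TensorAlgebra F 𝔤 := LinearMap.mk₂ F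
    (fun x y => tensorWord e A * L.rho (ε α β) x y * tensorWord e B)
    (fun x x' y => by
      simp only [rho, map_add, LinearMap.add_apply, add_mul, mul_add, mul_sub, sub_mul, smul_add]
      abel)
    (fun c x y => by
      simp only [rho, map_smul, LinearMap.smul_apply, smul_mul_assoc, mul_smul_comm, mul_sub,
        sub_mul]
      module)
    (fun x y y' => by
      simp only [rho, map_add, add_mul, mul_add, mul_sub, sub_mul, smul_add]
      abel)
    (fun c x y => by
      simp only [rho, map_smul, smul_mul_assoc, mul_smul_comm, mul_sub, sub_mul]
      module)
  have h1 : ∀ y ∈ e '' {i | d i = β}, x ∈ (L.lowRel d e w).comap (φ.flip y) := by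
    rintro _ ⟨b, rfl, rfl⟩
    refine Submodule.span_le.2 ?_ hx'
    rintro _ ⟨a, rfl, rfl⟩
    refine mul_rho_mul_mem_lowRel h2 he (Or.inl ?_) (Or.inl ?_) <;>
      simp only [List.length_append, List.length_cons, List.length_nil] <;> omega
  have h3 : y ∈ (L.lowRel d e w).comap (φ x) := Submodule.span_le.2 (fun y hy => h1 y hy) hy'
  exact h3

end LieColorAlgebra
end PBW

/-! ### Normal words and confluence of the rules. -/

section PBW

variable {Γ : Type*} {F : Type*} [AddCommGroup Γ] [Field F]
  {ε : Bicharacter Γ F} {n : ℕ} {d : Fin n → Γ}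

variable (ε d) in
/-- A word is normal if it is nondecreasing and contains every odd letter at most once. -/
def NormalWord (w : List (Fin n)) : Prop :=
  w.Pairwise fun i j => i < j ∨ (i = j ∧ ε.IsEven (d i))

lemma word_ne_of_normalWord (q : RuleIndex ε d) {w : List (Fin n)} (hw : NormalWord ε d w) :
    q.word ≠ w := by
  rintro rfl
  rw [NormalWord, RuleIndex.word, List.append_assoc, List.pairwise_append] at hw
  have h := hw.2.1
  simp only [List.cons_append, List.pairwise_cons, List.mem_cons] at h
  have h1 := h.1 q.snd (Or.inl rfl)
  rcases q.redex with h' | ⟨h', h''⟩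
  · rcases h1 with h1 | ⟨h1, -⟩ <;> omega
  · rcases h1 with h1 | ⟨h1, h1'⟩
    · omega
    · exact h'' h1'

variable [DecidableEq Γ] {𝔤 : Type*} [AddCommGroup 𝔤] [Module F 𝔤]
  {L : LieColorAlgebra ε 𝔤} {e : Basis (Fin n) F 𝔤}

variable (e) in
/-- The span of the words lower than `w`. -/
def lowWords (w : List (Fin n)) : Submodule F (TensorAlgebra F 𝔤) :=
  Submodule.span F (tensorWord e '' {u | WordLT u w})

lemma mul_mul_mem_lowWords {w : List (Fin n)} {x : TensorAlgebra F 𝔤} (hx : x ∈ lowWords e w)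
    (A B : List (Fin n)) : tensorWord e A * x * tensorWord e B ∈ lowWords e (A ++ w ++ B) := by
  induction hx using Submodule.span_induction with
  | mem x h =>
    obtain ⟨u, hu, rfl⟩ := h
    rw [← tensorWord_append, ← tensorWord_append]
    exact Submodule.subset_span ⟨_, hu.context A B, rfl⟩
  | zero => simp
  | add x y _ _ hx hy => rw [mul_add, add_mul]; exact add_mem hx hy
  | smul c x _ hx => rw [mul_smul_comm, smul_mul_assoc]; exact Submodule.smul_mem _ _ hx

lemma ι_mem_lowWords (x : 𝔤) {w : List (Fin n)} (hw : 1 < w.length) :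
    TensorAlgebra.ι F x ∈ lowWords e w := by
  rw [← e.sum_repr x, map_sum]
  refine Submodule.sum_mem _ fun i _ => ?_
  rw [map_smul, ← tensorWord_singleton]
  exact Submodule.smul_mem _ _ (Submodule.subset_span ⟨[i], Or.inl hw, rfl⟩)

namespace LieColorAlgebra

lemma mul_mul_mem_lowRel {w : List (Fin n)} {x : TensorAlgebra F 𝔤} (hx : x ∈ L.lowRel d e w)
    (A B : List (Fin n)) :
    tensorWord e A * x * tensorWord e B ∈ L.lowRel d e (A ++ w ++ B) := by
  induction hx using Submodule.span_induction with
  | mem x h =>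
    obtain ⟨⟨C, j, i, D, h⟩, hq, rfl⟩ := h
    refine Submodule.subset_span ⟨⟨A ++ C, j, i, D ++ B, h⟩, ?_, ?_⟩
    · have := WordLT.context hq A B
      simpa only [Set.mem_ofPred_eq, RuleIndex.word, List.append_assoc] using this
    · simp only [ruleAt, tensorWord_append, mul_assoc]
  | zero => simp
  | add x y _ _ hx hy => rw [mul_add, add_mul]; exact add_mem hx hy
  | smul c x _ hx => rw [mul_smul_comm, smul_mul_assoc]; exact Submodule.smul_mem _ _ hx

/-- Exchanging a descent lowers the weight. At a repeated odd letter the relation is 2x² - [x, x],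
which accounts for the factor 1/2 in `rule`. -/
lemma rule_sub_mem (h2 : (2 : F) ≠ 0) {j i : Fin n} (h : Redex ε d j i) :
    L.rule d e j i - tensorWord e [j, i] ∈ lowWords e [j, i] := by
  have hb : ∀ x, TensorAlgebra.ι F x ∈ lowWords e [j, i] := fun x => ι_mem_lowWords x (by simp)
  have hw : tensorWord e [j, i] = TensorAlgebra.ι F (e j) * TensorAlgebra.ι F (e i) := by
    simp [tensorWord]
  rcases h with h | ⟨rfl, h⟩
  · rw [rule, if_neg h.ne, one_smul, rho, hw, sub_right_comm, sub_sub_cancel_left]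
    refine sub_mem (neg_mem (Submodule.smul_mem _ _ ?_)) (hb _)
    refine Submodule.subset_span ⟨[i, j], Or.inr ⟨rfl, by simp [add_comm], ?_⟩, by simp [tensorWord]⟩
    simpa [wordWeight] using h
  · rw [rule, if_pos rfl, rho, hw, ε.coe_self_of_not_isEven h, neg_one_smul, sub_neg_eq_add,
      ← two_smul F, smul_sub, smul_smul, inv_mul_cancel₀ h2, one_smul, sub_right_comm, sub_self,
      zero_sub]
    exact neg_mem (Submodule.smul_mem _ _ (hb _))

/-- The ambiguities of the rewriting rules are resolvable. -/
lemma overlap_mem_lowRel (h2 : (2 : F) ≠ 0) (h3 : (3 : F) ≠ 0) (he : ∀ i, e i ∈ L.grade (d i))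
    {k j i : Fin n} (hkj : Redex ε d k j) (hji : Redex ε d j i) :
    L.rule d e k j * TensorAlgebra.ι F (e i) - TensorAlgebra.ι F (e k) * L.rule d e j i
      ∈ L.lowRel d e [k, j, i] := by
  have hlen : ∀ {α β : Γ} {x y : 𝔤}, x ∈ L.grade α → y ∈ L.grade β →
      L.rho (ε α β) x y ∈ L.lowRel d e [k, j, i] := by
    intro α β x y hx hy
    have := mul_rho_mul_mem_lowRel_of_length h2 he (A := []) (B := []) (w := [k, j, i]) hx hy
      (by simp)
    simpa [tensorWord] using this
  have hl : ∀ a b c : Fin n, WordLT [a, b, c] [k, j, i] → WordLT [a, c, b] [k, j, i] →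
      TensorAlgebra.ι F (e a) * L.rho (ε (d b) (d c)) (e b) (e c) ∈ L.lowRel d e [k, j, i] := by
    intro a b c h h'
    have := mul_rho_mul_mem_lowRel h2 he (A := [a]) (B := []) (by simpa using h) (by simpa using h')
    simpa [tensorWord] using this
  have hr : ∀ a b c : Fin n, WordLT [a, b, c] [k, j, i] → WordLT [b, a, c] [k, j, i] →
      L.rho (ε (d a) (d b)) (e a) (e b) * TensorAlgebra.ι F (e c) ∈ L.lowRel d e [k, j, i] := by
    intro a b c h h'
    have := mul_rho_mul_mem_lowRel h2 he (A := []) (B := [c]) (by simpa using h) (by simpa using h')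
    simpa [tensorWord] using this
  have hlow : L.rho (ε (d k) (d j + d i)) (e k) (L.bracket (e j) (e i))
      - L.rho (ε (d k + d j) (d i)) (L.bracket (e k) (e j)) (e i)
      + (ε (d j) (d i) : F) • L.rho (ε (d k + d i) (d j)) (L.bracket (e k) (e i)) (e j)
      ∈ L.lowRel d e [k, j, i] :=
    add_mem (sub_mem (hlen (he k) (L.bracket_mem (he j) (he i)))
      (hlen (L.bracket_mem (he k) (he j)) (he i)))
      (Submodule.smul_mem _ _ (hlen (L.bracket_mem (he k) (he i)) (he j)))
  have hid := L.rho_overlap (he k) (he j) (he i)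
  set R := L.rho (ε (d k) (d j + d i)) (e k) (L.bracket (e j) (e i))
      - L.rho (ε (d k + d j) (d i)) (L.bracket (e k) (e j)) (e i)
      + (ε (d j) (d i) : F) • L.rho (ε (d k + d i) (d j)) (L.bracket (e k) (e i)) (e j) with hR
  -- The weight of `[a, b, c]` is 2a + b.
  have wlt : ∀ a b c : Fin n, (a : ℕ) + b + c = k + j + i → 2 * (a : ℕ) + b < 2 * k + j →
      WordLT [a, b, c] [k, j, i] := by
    intro a b c h h'
    refine Or.inr ⟨rfl, ?_, ?_⟩ <;> simp [wordWeight] <;> omega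
  rcases hkj with hkj | ⟨rfl, hodd⟩
  · have hkj' : (j : ℕ) < k := hkj
    rcases hji with hji | ⟨rfl, hodd⟩
    · have hji' : (i : ℕ) < j := hji
      have m1 := hl j k i (wlt _ _ _ (by omega) (by omega)) (wlt _ _ _ (by omega) (by omega))
      have m2 := hr j i k (wlt _ _ _ (by omega) (by omega)) (wlt _ _ _ (by omega) (by omega))
      have m3 := hr k i j (wlt _ _ _ (by omega) (by omega)) (wlt _ _ _ (by omega) (by omega))
      have m4 := hl i k j (wlt _ _ _ (by omega) (by omega)) (wlt _ _ _ (by omega) (by omega))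
      rw [rule, rule, if_neg hkj.ne, if_neg hji.ne, one_smul, one_smul, hid]
      have := add_mem (add_mem (add_mem (sub_mem (neg_mem (Submodule.smul_mem _
        (ε (d k) (d j) : F) m1)) (Submodule.smul_mem _ ((ε (d k) (d j) : F) * ε (d k) (d i)) m2))
        (Submodule.smul_mem _ (ε (d j) (d i) : F) m3))
        (Submodule.smul_mem _ ((ε (d j) (d i) : F) * ε (d k) (d i)) m4)) hlow
      convert this using 1
      rw [hR]
      abel
    · have m1 := hl i k i (wlt _ _ _ (by omega) (by omega)) (wlt _ _ _ (by omega) (by omega))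
      have m2 := hr i i k (wlt _ _ _ (by omega) (by omega)) (wlt _ _ _ (by omega) (by omega))
      -- For j = i odd the term ρ(e_k, e_i) e_i occurs on both sides of the overlap identity with
      -- opposite signs. Collecting it gives twice the overlap, because ρ(e_i, e_i) is twice the
      -- rule.
      rw [ε.coe_self_of_not_isEven hodd] at hid
      refine (Submodule.smul_mem_iff _ h2).1 ?_
      rw [rule, rule, if_neg hkj.ne, if_pos rfl, one_smul, smul_sub, mul_smul_comm, smul_smul,
        mul_inv_cancel₀ h2, one_smul]
      have := add_mem (sub_mem (Submodule.smul_mem _ (-2 * (ε (d k) (d i) : F)) m1)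
        (Submodule.smul_mem _ ((ε (d k) (d i) : F) * ε (d k) (d i)) m2)) hlow
      convert this using 1
      simp only [hR, ε.coe_self_of_not_isEven hodd]
      linear_combination (norm := module) hid
  · rcases hji with hji | ⟨rfl, -⟩
    · have hji' : (i : ℕ) < j := hji
      have m1 := hr j i j (wlt _ _ _ (by omega) (by omega)) (wlt _ _ _ (by omega) (by omega))
      have m2 := hl i j j (wlt _ _ _ (by omega) (by omega)) (wlt _ _ _ (by omega) (by omega))
      rw [ε.coe_self_of_not_isEven hodd] at hid
      refine (Submodule.smul_mem_iff _ h2).1 ?_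
      rw [rule, rule, if_neg hji.ne, if_pos rfl, one_smul, smul_sub, smul_mul_assoc, smul_smul,
        mul_inv_cancel₀ h2, one_smul]
      have := add_mem (add_mem (Submodule.smul_mem _ (2 * (ε (d j) (d i) : F)) m1)
        (Submodule.smul_mem _ ((ε (d j) (d i) : F) * ε (d j) (d i)) m2)) hlow
      convert this using 1
      simp only [hR, ε.coe_self_of_not_isEven hodd]
      linear_combination (norm := module) hid
    -- For k = j = i odd the first four terms on the right of the identity are -2(ρx - xρ). It
    -- becomes 3(ρx - xρ) = R, with only short relations in R.
    · rw [ε.coe_self_of_not_isEven hodd] at hid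
      refine (Submodule.smul_mem_iff _ h2).1 ((Submodule.smul_mem_iff _ h3).1 ?_)
      rw [rule, if_pos rfl, smul_mul_assoc, mul_smul_comm, ← smul_sub, smul_smul (2 : F),
        mul_inv_cancel₀ h2, one_smul]
      convert hlow using 1
      rw [hR, ε.coe_self_of_not_isEven hodd]
      linear_combination (norm := module) hid

lemma ruleAt_sub_mem (h2 : (2 : F) ≠ 0) (q : RuleIndex ε d) :
    L.ruleAt e q - tensorWord e q.word ∈ lowWords e q.word := by
  have := mul_mul_mem_lowWords (rule_sub_mem (L := L) (e := e) h2 q.redex) q.pre q.suf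
  simpa only [ruleAt, RuleIndex.word, tensorWord_append, mul_sub, sub_mul] using this

/-- The difference of two overlapping or equal rules, the first one being further left. -/
lemma ruleAt_sub_ruleAt_mem_of_eq (h2 : (2 : F) ≠ 0) (h3 : (3 : F) ≠ 0)
    (he : ∀ i, e i ∈ L.grade (d i)) (q q' : RuleIndex ε d) {C : List (Fin n)}
    (hC : q'.pre = q.pre ++ C) (hs : [q.fst, q.snd] ++ q.suf = C ++ ([q'.fst, q'.snd] ++ q'.suf)) :
    L.ruleAt e q - L.ruleAt e q' ∈ L.lowRel d e q.word := by
  obtain ⟨A, j, i, B, h⟩ := q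
  obtain ⟨A', j', i', B', h'⟩ := q'
  simp only at hC hs
  subst hC
  rcases C with _ | ⟨c, _ | ⟨c', C⟩⟩
  · simp only [List.nil_append, List.cons_append, List.cons.injEq] at hs
    obtain ⟨rfl, rfl, rfl⟩ := hs
    simp [ruleAt]
  · simp only [List.nil_append, List.cons_append, List.cons.injEq] at hs
    obtain ⟨rfl, rfl, rfl⟩ := hs
    have := mul_mul_mem_lowRel (overlap_mem_lowRel h2 h3 he h h') A B'
    simp only [RuleIndex.word, List.append_assoc, List.cons_append, List.nil_append] at this ⊢
    simpa only [ruleAt, tensorWord_append, tensorWord_cons, tensorWord_nil, mul_one, mul_sub,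
      sub_mul, mul_assoc] using this
  · simp only [List.nil_append, List.cons_append, List.cons.injEq] at hs
    obtain ⟨rfl, rfl, rfl⟩ := hs
    -- For disjoint rules r, r' with leading words w, w' one has r C w' - w C r' = (r - w) C r' - r
    -- C (r' - w'). Both terms on the right are combinations of rules with lower leading words.
    have k1 : tensorWord e A * L.rule d e j i * tensorWord e C *
        (L.rule d e j' i' - tensorWord e [j', i']) * tensorWord e B'
        ∈ L.lowRel d e (A ++ [j, i] ++ (C ++ [j', i'] ++ B')) := by
      have hf := rule_sub_mem (L := L) (e := e) h2 h'
      generalize L.rule d e j' i' - tensorWord e [j', i'] = y at hf ⊢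
      induction hf using Submodule.span_induction with
      | mem x hx =>
        obtain ⟨u, hu, rfl⟩ := hx
        refine Submodule.subset_span ⟨⟨A, j, i, C ++ u ++ B', h⟩, ?_, ?_⟩
        · have := hu.context (A ++ [j, i] ++ C) B'
          simpa only [Set.mem_ofPred_eq, RuleIndex.word, List.append_assoc] using this
        · simp only [ruleAt, tensorWord_append, mul_assoc]
      | zero => simp
      | add x y _ _ hx hy => rw [mul_add, add_mul]; exact add_mem hx hy
      | smul c x _ hx => rw [mul_smul_comm, smul_mul_assoc]; exact Submodule.smul_mem _ _ hx
    have k2 : tensorWord e A * (L.rule d e j i - tensorWord e [j, i]) * tensorWord e C *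
        L.rule d e j' i' * tensorWord e B'
        ∈ L.lowRel d e (A ++ [j, i] ++ (C ++ [j', i'] ++ B')) := by
      have hf := rule_sub_mem (L := L) (e := e) h2 h
      generalize L.rule d e j i - tensorWord e [j, i] = y at hf ⊢
      induction hf using Submodule.span_induction with
      | mem x hx =>
        obtain ⟨u, hu, rfl⟩ := hx
        refine Submodule.subset_span ⟨⟨A ++ u ++ C, j', i', B', h'⟩, ?_, ?_⟩
        · have := hu.context A (C ++ [j', i'] ++ B')
          simpa only [Set.mem_ofPred_eq, RuleIndex.word, List.append_assoc] using this
        · simp only [ruleAt, tensorWord_append, mul_assoc]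
      | zero => simp
      | add x y _ _ hx hy => rw [mul_add, add_mul, add_mul, add_mul]; exact add_mem hx hy
      | smul c x _ hx =>
        rw [mul_smul_comm, smul_mul_assoc, smul_mul_assoc, smul_mul_assoc]
        exact Submodule.smul_mem _ _ hx
    have := sub_mem k2 k1
    simp only [RuleIndex.word, List.append_assoc, List.cons_append, List.nil_append] at this ⊢
    convert this using 1
    have hC' : ∀ u v w, tensorWord e (u ++ (v :: w :: B')) =
        tensorWord e u * tensorWord e [v, w] * tensorWord e B' := by
      intro u v w
      rw [mul_assoc, ← tensorWord_append, ← tensorWord_append]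
      rfl
    have hC'' : tensorWord e (j :: i :: C) = tensorWord e [j, i] * tensorWord e C := by
      rw [← tensorWord_append]
      rfl
    simp only [ruleAt, tensorWord_append, hC', hC'', mul_sub, sub_mul, mul_assoc]
    abel

lemma ruleAt_sub_ruleAt_mem (h2 : (2 : F) ≠ 0) (h3 : (3 : F) ≠ 0)
    (he : ∀ i, e i ∈ L.grade (d i)) (q q' : RuleIndex ε d) (h : q.word = q'.word) :
    L.ruleAt e q - L.ruleAt e q' ∈ L.lowRel d e q.word := by
  have h' := h
  rw [RuleIndex.word, RuleIndex.word, List.append_assoc, List.append_assoc,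
    List.append_eq_append_iff] at h'
  rcases h' with ⟨C, h4, h5⟩ | ⟨C, h4, h5⟩
  · exact ruleAt_sub_ruleAt_mem_of_eq h2 h3 he q q' h4 h5
  · have := ruleAt_sub_ruleAt_mem_of_eq h2 h3 he q' q h4 h5
    rw [← h] at this
    rw [← neg_sub]
    exact neg_mem this

/-- A combination of normal words that is a combination of relations vanishes. -/
lemma eq_zero_of_mem_span_ruleAt (h2 : (2 : F) ≠ 0) (h3 : (3 : F) ≠ 0)
    (he : ∀ i, e i ∈ L.grade (d i)) {v : TensorAlgebra F 𝔤}
    (hv : v ∈ Submodule.span F (Set.range (L.ruleAt e (ε := ε) (d := d))))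
    (hv' : v ∈ Submodule.span F (tensorWord e '' {w | NormalWord ε d w})) : v = 0 := by
  have hb : ⇑(wordBasis e) = tensorWord e := funext (wordBasis_apply e)
  refine eq_zero_of_mem_span_irreducible WordLT WordLT.wf (wordBasis e)
    (fun q : RuleIndex ε d => q.word) (L.ruleAt e) ?_ ?_ hv ?_
  · intro q
    rw [hb]
    exact ruleAt_sub_mem h2 q
  · exact ruleAt_sub_ruleAt_mem h2 h3 he
  · rw [hb]
    exact Submodule.span_mono (Set.image_mono fun w hw q => word_ne_of_normalWord q hw) hv'

end LieColorAlgebra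
end PBW

/-! ### The ideal of relations and linear independence of normal words. -/

section PBW

variable {Γ : Type*} {F : Type*} [AddCommGroup Γ] [DecidableEq Γ] [Field F]
  {ε : Bicharacter Γ F} {𝔤 : Type*} [AddCommGroup 𝔤] [Module F 𝔤]
  {n : ℕ} {d : Fin n → Γ} {L : LieColorAlgebra ε 𝔤} {e : Basis (Fin n) F 𝔤}

namespace LieColorAlgebra

variable (d L e) in
/-- The span of the rules. -/
def ruleSpan : Submodule F (TensorAlgebra F 𝔤) :=
  Submodule.span F (Set.range (L.ruleAt e (ε := ε) (d := d)))

lemma mul_mul_mem_ruleSpan {x : TensorAlgebra F 𝔤} (hx : x ∈ L.ruleSpan d e)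
    (a b : TensorAlgebra F 𝔤) : a * x * b ∈ L.ruleSpan d e := by
  have ha : a ∈ Submodule.span F (Set.range (tensorWord e)) := by
    rw [range_tensorWord_span]; trivial
  have hb : b ∈ Submodule.span F (Set.range (tensorWord e)) := by
    rw [range_tensorWord_span]; trivial
  induction ha using Submodule.span_induction with
  | mem a ha =>
    obtain ⟨A, rfl⟩ := ha
    induction hb using Submodule.span_induction with
    | mem b hb =>
      obtain ⟨B, rfl⟩ := hb
      induction hx using Submodule.span_induction with
      | mem x hx =>
        obtain ⟨q, rfl⟩ := hx
        refine Submodule.subset_span ⟨⟨A ++ q.pre, q.fst, q.snd, q.suf ++ B, q.redex⟩, ?_⟩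
        simp only [ruleAt, tensorWord_append, mul_assoc]
      | zero => simp
      | add x y _ _ hx hy => rw [mul_add, add_mul]; exact add_mem hx hy
      | smul c x _ hx => rw [mul_smul_comm, smul_mul_assoc]; exact Submodule.smul_mem _ _ hx
    | zero => simp
    | add x y _ _ hx hy => rw [mul_add]; exact add_mem hx hy
    | smul c x _ hx => rw [mul_smul_comm]; exact Submodule.smul_mem _ _ hx
  | zero => simp
  | add x y _ _ hx hy => rw [add_mul, add_mul]; exact add_mem hx hy
  | smul c x _ hx => rw [smul_mul_assoc, smul_mul_assoc]; exact Submodule.smul_mem _ _ hx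

variable (d L e) in
/-- The ideal of relations. -/
def ruleIdeal : Ideal (TensorAlgebra F 𝔤) where
  carrier := L.ruleSpan d e
  add_mem' := add_mem
  zero_mem' := zero_mem _
  smul_mem' a x hx := by simpa using mul_mul_mem_ruleSpan hx a 1

instance : (L.ruleIdeal d e).IsTwoSided where
  mul_mem_of_left {a} b ha := by
    have : 1 * a * b ∈ L.ruleSpan d e := mul_mul_mem_ruleSpan ha 1 b
    rwa [one_mul] at this

lemma rho_mem_ruleSpan (h2 : (2 : F) ≠ 0) (he : ∀ i, e i ∈ L.grade (d i)) {α β : Γ} {x y : 𝔤}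
    (hx : x ∈ L.grade α) (hy : y ∈ L.grade β) : L.rho (ε α β) x y ∈ L.ruleSpan d e := by
  rcases n with _ | n
  · have hx0 : x = 0 := by rw [← e.sum_repr x]; simp
    simp [rho, hx0]
  -- Any word of length greater than 2 serves as a bound. Writing one down takes a letter, hence the
  -- separate case of an empty basis.
  · have := mul_rho_mul_mem_lowRel_of_length h2 he (A := []) (B := []) (w := [0, 0, 0]) hx hy
      (by simp)
    rw [tensorWord_nil, one_mul, mul_one] at this
    exact Submodule.span_mono (Set.image_subset_range _ _) this

variable (L e) in
/-- The image of a word in the enveloping algebra. -/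
def envWord (w : List (Fin n)) : L.Env := (w.map fun i => L.envι (e i)).prod

lemma envMk_tensorWord (w : List (Fin n)) : L.envMk (tensorWord e w) = L.envWord e w := by
  simp only [tensorWord, envWord, map_list_prod, List.map_map]
  rfl

/-- The linear independence part of the Poincaré–Birkhoff–Witt theorem. -/
theorem linearIndependent_envWord (h2 : (2 : F) ≠ 0) (h3 : (3 : F) ≠ 0)
    (he : ∀ i, e i ∈ L.grade (d i)) :
    LinearIndependent F fun w : {w : List (Fin n) // NormalWord ε d w} => L.envWord e w := by
  have hw : (fun w : {w : List (Fin n) // NormalWord ε d w} => L.envWord e w)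
      = L.envMk.toLinearMap ∘ fun w => tensorWord e w.1 := by
    funext w
    exact (envMk_tensorWord w.1).symm
  have hi : LinearIndependent F fun w : {w : List (Fin n) // NormalWord ε d w} =>
      tensorWord e w.1 := by
    have := (wordBasis e).linearIndependent.comp
      (Subtype.val : {w : List (Fin n) // NormalWord ε d w} → _) Subtype.val_injective
    convert this using 2 with w
    exact (wordBasis_apply e _).symm
  rw [hw]
  refine hi.map ?_
  rw [Submodule.disjoint_def]
  intro v hv hv'
  refine eq_zero_of_mem_span_ruleAt h2 h3 he ?_ ?_ (d := d) (L := L) (e := e)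
  · refine RingQuot.mem_of_mkAlgHom_eq_zero (F := F) (L.ruleIdeal d e) ?_ hv'
    rintro _ _ ⟨x, y⟩
    exact rho_mem_ruleSpan h2 he x.2 y.2
  · rw [Set.image_eq_range]
    exact hv

lemma span_envWord : Submodule.span F (Set.range (L.envWord e)) = ⊤ := by
  have h : Set.range (L.envWord e) = L.envMk.toLinearMap '' Set.range (tensorWord e) := by
    rw [← Set.range_comp]
    congr 1
    funext w
    exact (envMk_tensorWord w).symm
  rw [h, Submodule.span_image, range_tensorWord_span, Submodule.map_top]
  exact LinearMap.range_eq_top.2 (RingQuot.mkAlgHom_surjective F _)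

end LieColorAlgebra
end PBW
end LieColor

/-! ### Algebras with a Poincaré–Birkhoff–Witt basis -/

section Filtration

variable {F A : Type*} [Field F] [Ring A] [Algebra F A] {n : ℕ} (x : Fin n → A)

/-- The product of the generators that correspond to the letters of a word. -/
def wordProd (w : List (Fin n)) : A := (w.map x).prod

lemma wordProd_append (u v : List (Fin n)) :
    wordProd x (u ++ v) = wordProd x u * wordProd x v := by
  simp [wordProd]

lemma wordProd_cons (i : Fin n) (v : List (Fin n)) :
    wordProd x (i :: v) = x i * wordProd x v := by
  simp [wordProd]

variable (F) in
/-- The span of the words of length less than `k`. -/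
def wordFiltration (k : ℕ) : Submodule F A :=
  Submodule.span F (wordProd x '' {w | w.length < k})

variable {x}

lemma wordProd_mem_wordFiltration {w : List (Fin n)} {k : ℕ} (h : w.length < k) :
    wordProd x w ∈ wordFiltration F x k :=
  Submodule.subset_span ⟨w, h, rfl⟩

lemma wordFiltration_mono {k l : ℕ} (h : k ≤ l) : wordFiltration F x k ≤ wordFiltration F x l :=
  Submodule.span_mono (Set.image_mono fun _ hw => lt_of_lt_of_le hw h)

/-- The bounds are strict: lengths of at most k - 1 and l - 1 add up to at most k + l - 2, which
must be less than m. -/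
lemma mul_mem_wordFiltration {k l m : ℕ} (h : k + l ≤ m + 1) {a b : A}
    (ha : a ∈ wordFiltration F x k) (hb : b ∈ wordFiltration F x l) :
    a * b ∈ wordFiltration F x m := by
  have : wordFiltration F x k * wordFiltration F x l ≤ wordFiltration F x m := by
    rw [wordFiltration, wordFiltration, Submodule.span_mul_span, Submodule.span_le]
    rintro _ ⟨_, ⟨u, hu, rfl⟩, _, ⟨v, hv, rfl⟩, rfl⟩
    refine Submodule.subset_span ⟨u ++ v, ?_, wordProd_append x u v⟩
    simp only [Set.mem_ofPred_eq, List.length_append] at hu hv ⊢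
    omega
  exact this (Submodule.mul_mem_mul ha hb)

variable (F x) in
/-- `a` is a nonzero multiple of the word `w`, up to shorter words. -/
def HasLeadingWord (a : A) (w : List (Fin n)) : Prop :=
  ∃ c : F, c ≠ 0 ∧ a - c • wordProd x w ∈ wordFiltration F x w.length

lemma HasLeadingWord.mem {a : A} {w : List (Fin n)} (h : HasLeadingWord F x a w) :
    a ∈ wordFiltration F x (w.length + 1) := by
  obtain ⟨c, -, h⟩ := h
  have := add_mem (wordFiltration_mono (Nat.le_succ _) h) (Submodule.smul_mem _ c
    (wordProd_mem_wordFiltration (F := F) (x := x) (Nat.lt_succ_self w.length)))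
  simpa using this

lemma hasLeadingWord_wordProd (w : List (Fin n)) : HasLeadingWord F x (wordProd x w) w :=
  ⟨1, one_ne_zero, by simp⟩

lemma HasLeadingWord.mul {a b : A} {u v : List (Fin n)} (ha : HasLeadingWord F x a u)
    (hb : HasLeadingWord F x b v) : HasLeadingWord F x (a * b) (u ++ v) := by
  have hb' := hb.mem
  obtain ⟨c, hc, h⟩ := ha
  obtain ⟨c', hc', h'⟩ := hb
  refine ⟨c * c', mul_ne_zero hc hc', ?_⟩
  have h1 := mul_mem_wordFiltration (m := (u ++ v).length) (by simp; omega) h hb'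
  have h2 := mul_mem_wordFiltration (m := (u ++ v).length) (by simp; omega)
    (wordProd_mem_wordFiltration (F := F) (x := x) (Nat.lt_succ_self u.length)) h'
  have := add_mem h1 (Submodule.smul_mem _ c h2)
  convert this using 1
  rw [wordProd_append, sub_mul, mul_sub, smul_sub, mul_smul_comm, smul_smul, smul_mul_assoc]
  abel

lemma hasLeadingWord_one : HasLeadingWord F x 1 [] := by
  simpa [wordProd] using hasLeadingWord_wordProd (F := F) (x := x) []

lemma HasLeadingWord.listProd {f : Fin n → A} {g : Fin n → List (Fin n)}
    (h : ∀ i, HasLeadingWord F x (f i) (g i)) (l : List (Fin n)) :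
    HasLeadingWord F x (l.map f).prod (l.flatMap g) := by
  induction l with
  | nil => simpa using hasLeadingWord_one
  | cons i l ih => simpa using (h i).mul ih

lemma HasLeadingWord.pow_replicate {a : A} {i : Fin n} {k : ℕ}
    (h : HasLeadingWord F x a (List.replicate k i)) (m : ℕ) :
    HasLeadingWord F x (a ^ m) (List.replicate (k * m) i) := by
  induction m with
  | zero => simpa using hasLeadingWord_one
  | succ m ih =>
    rw [pow_succ, Nat.mul_succ, List.replicate_add]
    exact ih.mul h

lemma hasLeadingWord_of_sub_pow_mem {a : A} {i : Fin n} {k : ℕ}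
    (h : a - x i ^ k ∈ wordFiltration F x k) : HasLeadingWord F x a (List.replicate k i) :=
  ⟨1, one_ne_zero, by simpa [wordProd] using h⟩

end Filtration

/-! ### Sorted words and exponents. -/

section Exponents

variable {n : ℕ}

/-- The nondecreasing word that contains the letter `i` with the multiplicity `m i`. -/
def exponentWord (m : Fin n → ℕ) : List (Fin n) :=
  (List.finRange n).flatMap fun i => List.replicate (m i) i

lemma count_flatMap_replicate (m : Fin n → ℕ) (i : Fin n) :
    ((List.finRange n).flatMap fun i => List.replicate (m i) i).count i = m i := by
  rw [List.count_flatMap]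
  simp only [Function.comp_def, List.count_replicate]
  have : ∀ l : List (Fin n), l.Nodup →
      (l.map fun j => if (j == i) = true then m j else 0).sum = if i ∈ l then m i else 0 := by
    intro l hl
    induction l with
    | nil => simp
    | cons j l ih =>
      rw [List.nodup_cons] at hl
      rw [List.map_cons, List.sum_cons, ih hl.2]
      by_cases hji : j = i
      · subst hji
        simp [hl.1]
      · simp [hji, Ne.symm hji]
  rw [this _ (List.nodup_finRange n)]
  simp

lemma count_exponentWord (m : Fin n → ℕ) (i : Fin n) : (exponentWord m).count i = m i :=
  count_flatMap_replicate m i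

lemma perm_exponentWord_iff {w : List (Fin n)} {m : Fin n → ℕ} :
    w.Perm (exponentWord m) ↔ ∀ i, w.count i = m i := by
  simp [List.perm_iff_count, count_exponentWord]

lemma length_exponentWord (m : Fin n → ℕ) : (exponentWord m).length = ∑ i, m i := by
  rw [exponentWord, List.length_flatMap, ← List.sum_ofFn, List.ofFn_eq_map]
  simp

lemma exponentWord_injective : Function.Injective (exponentWord (n := n)) := by
  intro m m' h
  funext i
  rw [← count_exponentWord m, h, count_exponentWord]

/-- An exponent is admissible if it is at most `1` at the odd indices. -/
def AdmissibleExponent (odd : Fin n → Prop) (m : Fin n → ℕ) : Prop := ∀ i, odd i → m i ≤ 1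

lemma pairwise_exponentWord {odd : Fin n → Prop} {m : Fin n → ℕ} (hm : AdmissibleExponent odd m) :
    (exponentWord m).Pairwise fun i j => i < j ∨ (i = j ∧ ¬ odd i) := by
  rw [exponentWord, List.pairwise_flatMap]
  refine ⟨fun i _ => ?_, ?_⟩
  · rw [List.pairwise_replicate]
    by_cases h : odd i
    · exact Or.inl (hm i h)
    · exact Or.inr (Or.inr ⟨rfl, h⟩)
  · refine (List.pairwise_lt_finRange n).imp ?_
    intro i j hij a ha b hb
    rw [List.eq_of_mem_replicate ha, List.eq_of_mem_replicate hb]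
    exact Or.inl hij

end Exponents

/-! ### Bases given by leading words. -/

section PBW

variable {F A : Type*} [Field F] [Ring A] [Algebra F A] {n : ℕ}

/-- The algebra `A` is generated by elements `x i` that commute up to scalars and lower terms, the
odd ones having lower squares, and the corresponding ordered monomials are linearly independent. -/
structure IsPBWAlgebra (F : Type*) {A : Type*} [Field F] [Ring A] [Algebra F A] {n : ℕ}
    (x : Fin n → A) (odd : Fin n → Prop) : Prop where
  swap : ∀ i j, ∃ c : F, c ≠ 0 ∧ x i * x j - c • (x j * x i) ∈ wordFiltration F x 2
  sq : ∀ i, odd i → x i * x i ∈ wordFiltration F x 2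
  linearIndependent : LinearIndependent F
    fun w : {w : List (Fin n) // w.Pairwise fun i j => i < j ∨ (i = j ∧ ¬ odd i)} => wordProd x w.1
  span : Submodule.span F (Set.range (wordProd x)) = ⊤

end PBW

section PBW

variable {F A : Type*} [Field F] [Ring A] [Algebra F A] {n : ℕ} {x : Fin n → A}

lemma HasLeadingWord.trans {a : A} {u v : List (Fin n)} (h : HasLeadingWord F x a u)
    (h' : HasLeadingWord F x (wordProd x u) v) (huv : u.length = v.length) :
    HasLeadingWord F x a v := by
  obtain ⟨c, hc, h⟩ := h
  obtain ⟨c', hc', h'⟩ := h'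
  refine ⟨c * c', mul_ne_zero hc hc', ?_⟩
  rw [huv] at h
  have := add_mem h (Submodule.smul_mem _ c h')
  convert this using 1
  module

namespace IsPBWAlgebra

variable {odd : Fin n → Prop} (hA : IsPBWAlgebra F x odd)
include hA

/-- Exchanging adjacent letters costs a nonzero scalar and shorter words, and such exchanges
generate all permutations. -/
lemma hasLeadingWord_wordProd_of_perm {u v : List (Fin n)} (h : u.Perm v) :
    HasLeadingWord F x (wordProd x u) v := by
  induction h with
  | nil => exact hasLeadingWord_wordProd _
  | @cons i l₁ l₂ _ ih =>
    have := (hasLeadingWord_wordProd (F := F) (x := x) [i]).mul ih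
    rwa [← wordProd_append] at this
  | swap i j l =>
    obtain ⟨c, hc, h⟩ := hA.swap j i
    have h1 : HasLeadingWord F x (x j * x i) [i, j] := ⟨c, hc, by simpa [wordProd] using h⟩
    have := h1.mul (hasLeadingWord_wordProd (F := F) (x := x) l)
    rwa [show x j * x i * wordProd x l = wordProd x (j :: i :: l) by
      simp [wordProd, mul_assoc]] at this
  | trans h h' ih ih' => exact ih.trans ih' h'.length_eq

lemma hasLeadingWord_of_perm {a : A} {u v : List (Fin n)} (h : HasLeadingWord F x a u)
    (huv : u.Perm v) : HasLeadingWord F x a v :=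
  h.trans (hA.hasLeadingWord_wordProd_of_perm huv) huv.length_eq

lemma hasLeadingWord_exponentWord {a : A} {u : List (Fin n)} (h : HasLeadingWord F x a u) :
    HasLeadingWord F x a (exponentWord fun i => u.count i) :=
  hA.hasLeadingWord_of_perm h (perm_exponentWord_iff.2 fun _ => rfl)

/-- A word that repeats an odd letter is a combination of shorter words. -/
lemma wordProd_mem_of_not_admissible {m : Fin n → ℕ} (hm : ¬ AdmissibleExponent odd m) :
    wordProd x (exponentWord m) ∈ wordFiltration F x (exponentWord m).length := by
  simp only [AdmissibleExponent, not_forall, not_le] at hm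
  obtain ⟨i, hi, h⟩ := hm
  -- Two copies of the odd letter can be permuted to the front, where their product is a combination
  -- of words of length at most 1.
  have hsub : [i, i].Subperm (exponentWord m) := by
    rw [List.subperm_ext_iff]
    intro j hj
    have : j = i := by simpa using hj
    subst this
    rw [count_exponentWord]
    simpa [Nat.succ_le_iff] using h
  obtain ⟨l', hp, hs⟩ := hsub
  obtain ⟨l, hl'⟩ := hs.exists_perm_append
  have hl : (exponentWord m).Perm ([i, i] ++ l) := hl'.trans (hp.append_right l)
  obtain ⟨c, -, h'⟩ := hA.hasLeadingWord_wordProd_of_perm hl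
  have h1 : wordProd x ([i, i] ++ l) ∈ wordFiltration F x ([i, i] ++ l).length := by
    rw [wordProd_append]
    refine mul_mem_wordFiltration (k := 2) (l := l.length + 1) (by simp; omega) ?_
      (wordProd_mem_wordFiltration (Nat.lt_succ_self _))
    simpa [wordProd] using hA.sq i hi
  have := add_mem h' (Submodule.smul_mem _ c h1)
  rw [hl.length_eq]
  simpa using this

section Family

variable {v : (Fin n → ℕ) → A} (hv : ∀ m, HasLeadingWord F x (v m) (exponentWord m))
include hv

/-- Elements with leading words of all admissible exponents span the algebra. -/
lemma wordFiltration_le_span (k : ℕ) : wordFiltration F x k ≤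
    Submodule.span F (v '' {m | AdmissibleExponent odd m ∧ ∑ i, m i < k}) := by
  induction k with
  | zero =>
    rw [wordFiltration, Submodule.span_le]
    rintro _ ⟨w, hw, rfl⟩
    exact absurd hw (Nat.not_lt_zero _)
  | succ k ih =>
    have hmono := Submodule.span_mono (R := F) (Set.image_mono (f := v)
      (s := {m | AdmissibleExponent odd m ∧ ∑ i, m i < k})
      (t := {m | AdmissibleExponent odd m ∧ ∑ i, m i < k + 1}) fun m hm => ⟨hm.1, hm.2.trans (by omega)⟩)
    rw [wordFiltration, Submodule.span_le]
    rintro _ ⟨w, hw, rfl⟩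
    have hlen : (exponentWord fun i => w.count i).length = w.length :=
      ((perm_exponentWord_iff.2 fun _ => rfl).length_eq (l₁ := w)).symm
    have hk : w.length ≤ k := Nat.lt_succ_iff.1 hw
    obtain ⟨c, hc, h⟩ := hA.hasLeadingWord_exponentWord (hasLeadingWord_wordProd (F := F) w)
    rw [hlen] at h
    have h' := hmono (ih (wordFiltration_mono hk h))
    have h2 : wordProd x (exponentWord fun i => w.count i) ∈
        Submodule.span F (v '' {m | AdmissibleExponent odd m ∧ ∑ i, m i < k + 1}) := by
      -- The sorted word is traded for the family member with the same leading word, or, if an odd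
      -- letter repeats, for shorter words; the induction hypothesis absorbs the remainder.
      by_cases hadm : AdmissibleExponent odd fun i => w.count i
      · obtain ⟨c', hc', h3⟩ := hv fun i => w.count i
        rw [hlen] at h3
        have h4 := hmono (ih (wordFiltration_mono hk h3))
        have h5 : v (fun i => w.count i) ∈
            Submodule.span F (v '' {m | AdmissibleExponent odd m ∧ ∑ i, m i < k + 1}) := by
          refine Submodule.subset_span ⟨_, ⟨hadm, ?_⟩, rfl⟩
          rw [← length_exponentWord, hlen]
          exact hw
        have h6 := sub_mem h5 h4
        rw [sub_sub_cancel] at h6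
        exact (Submodule.smul_mem_iff _ hc').1 h6
      · have h3 := hA.wordProd_mem_of_not_admissible hadm
        rw [hlen] at h3
        exact hmono (ih (wordFiltration_mono hk h3))
    have := add_mem h' (Submodule.smul_mem _ c h2)
    simpa using this

lemma top_le_span : ⊤ ≤ Submodule.span F
    (Set.range fun m : {m : Fin n → ℕ // AdmissibleExponent odd m} => v m.1) := by
  rw [← hA.span, Submodule.span_le]
  rintro _ ⟨w, rfl⟩
  refine Submodule.span_mono ?_ (hA.wordFiltration_le_span hv (w.length + 1)
    (wordProd_mem_wordFiltration (Nat.lt_succ_self _)))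
  rintro _ ⟨m, hm, rfl⟩
  exact ⟨⟨m, hm.1⟩, rfl⟩

end Family

lemma linearIndependent_wordProd_exponentWord : LinearIndependent F
    fun m : {m : Fin n → ℕ // AdmissibleExponent odd m} => wordProd x (exponentWord m.1) := by
  let f : {m : Fin n → ℕ // AdmissibleExponent odd m} →
      {w : List (Fin n) // w.Pairwise fun i j => i < j ∨ (i = j ∧ ¬ odd i)} :=
    fun m => ⟨exponentWord m.1, pairwise_exponentWord m.2⟩
  have hf : Function.Injective f := fun m m' h =>
    Subtype.ext (exponentWord_injective (Subtype.ext_iff.1 h))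
  exact hA.linearIndependent.comp f hf

/-- In the basis of sorted monomials, the family is triangular with respect to the total degree,
with nonzero diagonal entries and no other entries within one degree. A term of highest degree in a
linear relation therefore cannot cancel. -/
lemma linearIndependent_of_hasLeadingWord {v : (Fin n → ℕ) → A}
    (hv : ∀ m, HasLeadingWord F x (v m) (exponentWord m)) : LinearIndependent F
    fun m : {m : Fin n → ℕ // AdmissibleExponent odd m} => v m.1 := by
  classical
  have hl : ∀ m, HasLeadingWord F x (wordProd x (exponentWord m)) (exponentWord m) :=
    fun m => hasLeadingWord_wordProd _
  obtain ⟨B, hB⟩ : ∃ B : Basis {m : Fin n → ℕ // AdmissibleExponent odd m} F A,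
      ∀ m, B m = wordProd x (exponentWord m.1) :=
    ⟨Basis.mk hA.linearIndependent_wordProd_exponentWord
      (hA.top_le_span (v := fun m => wordProd x (exponentWord m)) hl), Basis.mk_apply _ _⟩
  have hlow : ∀ (a : A) (m : {m : Fin n → ℕ // AdmissibleExponent odd m}),
      a ∈ wordFiltration F x (∑ i, m.1 i) → B.repr a m = 0 := by
    intro a m ha
    have h1 : a ∈ Submodule.span F (B '' {m' | ∑ i, m'.1 i < ∑ i, m.1 i}) := by
      refine Submodule.span_mono ?_ (hA.wordFiltration_le_span hl _ ha)
      rintro _ ⟨m', hm', rfl⟩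
      exact ⟨⟨m', hm'.1⟩, hm'.2, hB _⟩
    by_contra h
    have h2 : ∑ i, m.1 i < ∑ i, m.1 i := B.mem_span_image.1 h1 (Finsupp.mem_support_iff.2 h)
    exact lt_irrefl _ h2
  rw [linearIndependent_iff]
  intro l hlc
  by_contra hne
  obtain ⟨m, hm, hmax⟩ := l.support.exists_max_image (fun m => ∑ i, m.1 i)
    (Finsupp.support_nonempty_iff.2 hne)
  have h0 := congrArg (fun a => B.repr a m) hlc
  simp only [Finsupp.linearCombination_apply, Finsupp.sum, map_sum, map_smul, map_zero,
    Finsupp.finsetSum_apply, Finsupp.smul_apply, Finsupp.zero_apply] at h0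
  have hrepr : ∀ m' ∈ l.support, ∃ c : F, c ≠ 0 ∧
      B.repr (v m'.1) m = c * B.repr (B m') m := by
    intro m' hm'
    obtain ⟨c, hc, h⟩ := hv m'.1
    rw [length_exponentWord] at h
    have h1 := hlow _ m (wordFiltration_mono (hmax m' hm') h)
    refine ⟨c, hc, ?_⟩
    rw [map_sub, Finsupp.sub_apply, sub_eq_zero, map_smul, Finsupp.smul_apply, ← hB m'] at h1
    exact h1
  rw [Finset.sum_eq_single m] at h0
  · obtain ⟨c, hc, h⟩ := hrepr m hm
    rw [h, B.repr_self, Finsupp.single_eq_same, mul_one, smul_eq_mul] at h0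
    exact (mul_ne_zero (Finsupp.mem_support_iff.1 hm) hc) h0
  · intro m' hm' hne'
    obtain ⟨c, hc, h⟩ := hrepr m' hm'
    rw [h, B.repr_self, Finsupp.single_eq_of_ne hne'.symm, mul_zero, smul_zero]
  · exact fun h => absurd hm h

/-- The basis formed by elements with leading words of all admissible exponents. -/
def basis {v : (Fin n → ℕ) → A} (hv : ∀ m, HasLeadingWord F x (v m) (exponentWord m)) :
    Basis {m : Fin n → ℕ // AdmissibleExponent odd m} F A :=
  Basis.mk (hA.linearIndependent_of_hasLeadingWord hv) (hA.top_le_span hv)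

lemma basis_apply {v : (Fin n → ℕ) → A} (hv : ∀ m, HasLeadingWord F x (v m) (exponentWord m))
    (m : {m : Fin n → ℕ // AdmissibleExponent odd m}) : hA.basis hv m = v m.1 :=
  Basis.mk_apply _ _ _

lemma basis_repr_eq_zero {v : (Fin n → ℕ) → A}
    (hv : ∀ m, HasLeadingWord F x (v m) (exponentWord m))
    (m : {m : Fin n → ℕ // AdmissibleExponent odd m}) {a : A}
    (ha : a ∈ wordFiltration F x (∑ i, m.1 i)) : (hA.basis hv).repr a m = 0 := by
  have h1 : a ∈ Submodule.span F (hA.basis hv '' {m' | ∑ i, m'.1 i < ∑ i, m.1 i}) := by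
    refine Submodule.span_mono ?_ (hA.wordFiltration_le_span hv _ ha)
    rintro _ ⟨m', hm', rfl⟩
    exact ⟨⟨m', hm'.1⟩, hm'.2, hA.basis_apply hv _⟩
  by_contra h
  have h2 : ∑ i, m.1 i < ∑ i, m.1 i :=
    (hA.basis hv).mem_span_image.1 h1 (Finsupp.mem_support_iff.2 h)
  exact lt_irrefl _ h2

/-- The coordinate of an element with a leading word `w` at an exponent of the degree `|w|`. -/
lemma basis_repr_ne_zero_iff {v : (Fin n → ℕ) → A}
    (hv : ∀ m, HasLeadingWord F x (v m) (exponentWord m))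
    (m : {m : Fin n → ℕ // AdmissibleExponent odd m}) {a : A} {w : List (Fin n)}
    (ha : HasLeadingWord F x a w) (hw : w.length ≤ ∑ i, m.1 i) :
    (hA.basis hv).repr a m ≠ 0 ↔ ∀ i, w.count i = m.1 i := by
  classical
  set k : Fin n → ℕ := fun i => w.count i with hk
  have hlen : (exponentWord k).length = w.length :=
    ((perm_exponentWord_iff.2 fun _ => rfl).length_eq (l₁ := w)).symm
  obtain ⟨c, hc, h⟩ := hA.hasLeadingWord_exponentWord ha
  have h1 := hA.basis_repr_eq_zero hv m (wordFiltration_mono (hlen.le.trans hw) h)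
  by_cases hadm : AdmissibleExponent odd k
  · obtain ⟨c', hc', h'⟩ := hv k
    have h2 := hA.basis_repr_eq_zero hv m (wordFiltration_mono (hlen.le.trans hw) h')
    have h3 : (hA.basis hv).repr (v k) m = if (⟨k, hadm⟩ : {m // AdmissibleExponent odd m}) = m
        then 1 else 0 := by
      rw [← hA.basis_apply hv ⟨k, hadm⟩, Basis.repr_self, Finsupp.single_apply]
    rw [map_sub, Finsupp.sub_apply, sub_eq_zero, map_smul, Finsupp.smul_apply] at h1 h2
    rw [h1, smul_ne_zero_iff]
    have h4 : (hA.basis hv).repr (wordProd x (exponentWord k)) m ≠ 0 ↔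
        (hA.basis hv).repr (v k) m ≠ 0 := by
      rw [h2, smul_ne_zero_iff]
      exact ⟨fun h => ⟨hc', h⟩, fun h => h.2⟩
    rw [← hk, h4, h3]
    have h5 : (⟨k, hadm⟩ : {m // AdmissibleExponent odd m}) = m ↔ ∀ i, w.count i = m.1 i := by
      rw [Subtype.ext_iff, funext_iff]
    rw [← h5]
    split_ifs with h6 <;> simp [hc, h6]
  · have h2 := hA.wordProd_mem_of_not_admissible hadm
    have h3 := hA.basis_repr_eq_zero hv m (wordFiltration_mono (hlen.le.trans hw) h2)
    rw [map_sub, Finsupp.sub_apply, sub_eq_zero, map_smul, Finsupp.smul_apply, ← hk, h3,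
      smul_zero] at h1
    refine ⟨fun h => absurd h1 h, fun h => absurd ?_ hadm⟩
    have : k = m.1 := funext h
    rw [this]
    exact m.2

end IsPBWAlgebra
end PBW

/-! ### Normal families and the top coordinate. -/

section Normal

variable {F A : Type*} [Field F] [Ring A] [Algebra F A] {n : ℕ}

/-- Elements `h i` with the leading words `x i ^ N i` which, for even `i`, commute up to scalars
with the generators and with each other. -/
structure IsNormalFamily (F : Type*) {A : Type*} [Field F] [Ring A] [Algebra F A] {n : ℕ}
    (x : Fin n → A) (odd : Fin n → Prop) (h : Fin n → A) (N : Fin n → ℕ) : Prop where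
  pos : ∀ i, 0 < N i
  eq_two : ∀ i, odd i → N i = 2
  lead : ∀ i, h i - x i ^ N i ∈ wordFiltration F x (N i)
  mul_gen : ∀ i, ¬ odd i → ∀ j, ∃ c : F, x j * h i = c • (h i * x j)
  mul_comm : ∀ i, ¬ odd i → ∀ j, ∃ c : F, h i * h j = c • (h j * h i)

/-- The ideal generated by the elements `h i` for even `i`. -/
def normalIdeal {n : ℕ} (odd : Fin n → Prop) (h : Fin n → A) : Ideal A :=
  Ideal.span {a | ∃ i b, ¬ odd i ∧ a = h i * b}

/-- `Ideal.span` closes under left multiplication only. The right factors `b` among the generators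
make the ideal two-sided, with no commutation rule involved. -/
instance {n : ℕ} (odd : Fin n → Prop) (h : Fin n → A) : (normalIdeal odd h).IsTwoSided where
  mul_mem_of_left {a} b ha := by
    unfold normalIdeal at ha ⊢
    induction ha using Submodule.span_induction with
    | mem a ha =>
      obtain ⟨i, c, hi, rfl⟩ := ha
      exact Submodule.subset_span ⟨i, c * b, hi, mul_assoc _ _ _⟩
    | zero => simp
    | add a a' _ _ ha ha' => rw [add_mul]; exact add_mem ha ha'
    | smul c a _ ha => rw [smul_mul_assoc]; exact Submodule.smul_mem _ _ ha

lemma mem_normalIdeal {n : ℕ} {odd : Fin n → Prop} {h : Fin n → A} {i : Fin n} (hi : ¬ odd i) :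
    h i ∈ normalIdeal odd h :=
  Submodule.subset_span ⟨i, 1, hi, (mul_one _).symm⟩

variable {x : Fin n → A} {odd : Fin n → Prop} {h : Fin n → A} {N : Fin n → ℕ}

/-- The monomial of exponent `m` in the elements `h i` and `x i`. -/
def normalMonomial (x h : Fin n → A) (N m : Fin n → ℕ) : A :=
  ((List.finRange n).map fun i => h i ^ (m i / N i)).prod *
    ((List.finRange n).map fun i => x i ^ (m i % N i)).prod

namespace IsNormalFamily

variable (hh : IsNormalFamily F x odd h N)
include hh

/-- Euclidean division of every exponent: N_i (m_i / N_i) + m_i % N_i = m_i. So each exponent is the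
leading exponent of exactly one monomial in the `h i` and `x i`. -/
lemma hasLeadingWord_normalMonomial (hA : IsPBWAlgebra F x odd) (m : Fin n → ℕ) :
    HasLeadingWord F x (normalMonomial x h N m) (exponentWord m) := by
  have h1 : ∀ i, HasLeadingWord F x (h i ^ (m i / N i))
      (List.replicate (N i * (m i / N i)) i) := fun i =>
    (hasLeadingWord_of_sub_pow_mem (hh.lead i)).pow_replicate _
  have h2 : ∀ i, HasLeadingWord F x (x i ^ (m i % N i)) (List.replicate (m i % N i) i) := by
    intro i
    have := hasLeadingWord_wordProd (F := F) (x := x) (List.replicate (m i % N i) i)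
    simpa [wordProd] using this
  refine hA.hasLeadingWord_of_perm
    ((HasLeadingWord.listProd h1 _).mul (HasLeadingWord.listProd h2 _)) ?_
  rw [perm_exponentWord_iff]
  intro i
  rw [List.count_append, count_flatMap_replicate, count_flatMap_replicate, Nat.div_add_mod]

lemma mul_pow_comm {i : Fin n} (hi : ¬ odd i) (j : Fin n) (k : ℕ) :
    ∃ c : F, h i * h j ^ k = c • (h j ^ k * h i) := by
  induction k with
  | zero => exact ⟨1, by simp⟩
  | succ k ih =>
    obtain ⟨c, hc⟩ := ih
    obtain ⟨c', hc'⟩ := hh.mul_comm i hi j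
    refine ⟨c * c', ?_⟩
    rw [pow_succ, ← mul_assoc, hc, smul_mul_assoc, mul_assoc, hc', mul_smul_comm, smul_smul,
      mul_assoc]

lemma mul_listProd {i : Fin n} (hi : ¬ odd i) (a : Fin n → ℕ) (l : List (Fin n)) (hl : l.Nodup)
    (hil : i ∈ l) : ∃ c : F, h i * (l.map fun j => h j ^ a j).prod =
      c • (l.map fun j => h j ^ (Function.update a i (a i + 1)) j).prod := by
  induction l with
  | nil => simp at hil
  | cons k l ih =>
    rw [List.nodup_cons] at hl
    simp only [List.map_cons, List.prod_cons]
    by_cases hki : k = i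
    · subst hki
      refine ⟨1, ?_⟩
      rw [one_smul, Function.update_self, pow_succ', mul_assoc]
      congr 3
      refine List.map_congr_left fun j hj => ?_
      rw [Function.update_of_ne]
      rintro rfl
      exact hl.1 hj
    · have hil' : i ∈ l := by
        rcases List.mem_cons.1 hil with h | h
        · exact absurd h.symm hki
        · exact h
      obtain ⟨c, hc⟩ := ih hl.2 hil'
      obtain ⟨c', hc'⟩ := hh.mul_pow_comm hi k (a k)
      refine ⟨c' * c, ?_⟩
      rw [← mul_assoc, hc', smul_mul_assoc, mul_assoc, hc, mul_smul_comm, smul_smul,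
        Function.update_of_ne hki]

/-- The factor `h i` moves through the other `h j` up to scalars. Raising m_i by N_i raises the
quotient by 1 and keeps the remainder, so the part in the `x j` is unchanged. -/
lemma mul_normalMonomial {i : Fin n} (hi : ¬ odd i) (m : Fin n → ℕ) :
    ∃ c : F, h i * normalMonomial x h N m =
      c • normalMonomial x h N (Function.update m i (m i + N i)) := by
  obtain ⟨c, hc⟩ := hh.mul_listProd hi (fun j => m j / N j) (List.finRange n)
    (List.nodup_finRange n) (List.mem_finRange i)
  refine ⟨c, ?_⟩
  rw [normalMonomial, ← mul_assoc, hc, smul_mul_assoc, normalMonomial]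
  congr 4
  · funext j
    by_cases hj : j = i
    · subst hj
      rw [Function.update_self, Function.update_self, Nat.add_div_right _ (hh.pos j)]
    · rw [Function.update_of_ne hj, Function.update_of_ne hj]
  · funext j
    by_cases hj : j = i
    · subst hj
      rw [Function.update_self, Nat.add_mod_right]
    · rw [Function.update_of_ne hj]

/-- The exponent of the highest monomial. -/
lemma admissible_top : AdmissibleExponent odd fun i => N i - 1 := by
  intro i hi
  simp [hh.eq_two i hi]

/-- The coordinate functional of the highest monomial. -/
def topCoord (hA : IsPBWAlgebra F x odd) : A →ₗ[F] F :=
  (hA.basis (hh.hasLeadingWord_normalMonomial hA)).coord ⟨_, hh.admissible_top⟩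

lemma topCoord_ne_zero_iff (hA : IsPBWAlgebra F x odd) {a : A} {w : List (Fin n)}
    (ha : HasLeadingWord F x a w) (hw : w.length ≤ ∑ i, (N i - 1)) :
    hh.topCoord hA a ≠ 0 ↔ ∀ i, w.count i = N i - 1 :=
  hA.basis_repr_ne_zero_iff (hh.hasLeadingWord_normalMonomial hA) ⟨_, hh.admissible_top⟩ ha hw

/-- On the basis of monomials, multiplication by `h i` produces an exponent of at least N_i at `i`,
whereas the top exponent there is N_i - 1. -/
lemma topCoord_mul_eq_zero (hA : IsPBWAlgebra F x odd) {i : Fin n} (hi : ¬ odd i) (b : A) :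
    hh.topCoord hA (h i * b) = 0 := by
  have hb := hA.top_le_span (hh.hasLeadingWord_normalMonomial hA) (Submodule.mem_top (x := b))
  induction hb using Submodule.span_induction with
  | mem b hb =>
    obtain ⟨m, rfl⟩ := hb
    obtain ⟨c, hc⟩ := hh.mul_normalMonomial hi m.1
    have hadm : AdmissibleExponent odd (Function.update m.1 i (m.1 i + N i)) := by
      intro j hj
      rw [Function.update_of_ne (by rintro rfl; exact hi hj)]
      exact m.2 j hj
    have h1 := hA.basis_apply (hh.hasLeadingWord_normalMonomial hA) ⟨_, hadm⟩
    simp only at h1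
    simp only [hc, ← h1, map_smul, topCoord, Basis.coord_apply, Basis.repr_self]
    rw [Finsupp.single_eq_of_ne, smul_zero]
    intro h2
    have h3 := congrFun (congrArg Subtype.val h2) i
    simp only [Function.update_self] at h3
    have := hh.pos i
    omega
  | zero => simp
  | add a b _ _ ha hb => rw [mul_add, map_add, ha, hb, add_zero]
  | smul c a _ ha => rw [mul_smul_comm, map_smul, ha, smul_zero]

/-- The generators can be moved to the left past every `h i` at the cost of a scalar. So the mere
linear span of the products `h i * b` is already the whole ideal. -/
lemma topCoord_eq_zero_of_mem (hA : IsPBWAlgebra F x odd) {a : A} (ha : a ∈ normalIdeal odd h) :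
    hh.topCoord hA a = 0 := by
  let S : Submodule F A := Submodule.span F {a | ∃ i b, ¬ odd i ∧ a = h i * b}
  have hS : S ≤ LinearMap.ker (hh.topCoord hA) := by
    rw [Submodule.span_le]
    rintro _ ⟨i, b, hi, rfl⟩
    exact hh.topCoord_mul_eq_zero hA hi b
  have hgen : ∀ j, ∀ s ∈ S, x j * s ∈ S := by
    intro j s hs
    induction hs using Submodule.span_induction with
    | mem s hs =>
      obtain ⟨i, b, hi, rfl⟩ := hs
      obtain ⟨c, hc⟩ := hh.mul_gen i hi j
      rw [← mul_assoc, hc, smul_mul_assoc, mul_assoc]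
      exact Submodule.smul_mem _ _ (Submodule.subset_span ⟨i, _, hi, rfl⟩)
    | zero => simp
    | add a b _ _ ha hb => rw [mul_add]; exact add_mem ha hb
    | smul c a _ ha => rw [mul_smul_comm]; exact Submodule.smul_mem _ _ ha
  have hword : ∀ w : List (Fin n), ∀ s ∈ S, wordProd x w * s ∈ S := by
    intro w s hs
    induction w with
    | nil => simpa [wordProd] using hs
    | cons j w ih => rw [wordProd_cons, mul_assoc]; exact hgen j _ ih
  have hmul : ∀ a : A, ∀ s ∈ S, a * s ∈ S := by
    intro a s hs
    have ha : a ∈ Submodule.span F (Set.range (wordProd x)) := by rw [hA.span]; trivial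
    induction ha using Submodule.span_induction with
    | mem a ha =>
      obtain ⟨w, rfl⟩ := ha
      exact hword w s hs
    | zero => simp
    | add a b _ _ ha hb => rw [add_mul]; exact add_mem ha hb
    | smul c a _ ha => rw [smul_mul_assoc]; exact Submodule.smul_mem _ _ ha
  refine hS ?_
  unfold normalIdeal at ha
  induction ha using Submodule.span_induction with
  | mem a ha => exact Submodule.subset_span ha
  | zero => exact zero_mem _
  | add a b _ _ ha hb => exact add_mem ha hb
  | smul c a _ ha => exact hmul c a ha

/-- An odd `i` is impossible here, since then N_i = 2 and m_i ≤ 1. For even `i` the monomial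
contains a positive power of `h i`. -/
lemma normalMonomial_mem {m : Fin n → ℕ} (hm : AdmissibleExponent odd m) {i : Fin n}
    (hi : N i ≤ m i) : normalMonomial x h N m ∈ normalIdeal odd h := by
  have hodd : ¬ odd i := fun ho => by
    have := hm i ho
    have := hh.eq_two i ho
    omega
  rw [← Ideal.Quotient.eq_zero_iff_mem, normalMonomial, map_mul, map_list_prod, List.prod_eq_zero,
    zero_mul]
  rw [List.map_map, List.mem_map]
  refine ⟨i, List.mem_finRange i, ?_⟩
  rw [Function.comp_apply, map_pow, Ideal.Quotient.eq_zero_iff_mem.2 (mem_normalIdeal hodd),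
    zero_pow]
  exact (Nat.div_pos hi (hh.pos i)).ne'

lemma exists_reduced (hA : IsPBWAlgebra F x odd) (a : A) :
    ∃ l : {m : Fin n → ℕ // AdmissibleExponent odd m} →₀ F,
      (∀ m ∈ l.support, ∀ i, m.1 i < N i) ∧
      a - l.sum (fun m c => c • normalMonomial x h N m.1) ∈ normalIdeal odd h := by
  classical
  set B := hA.basis (hh.hasLeadingWord_normalMonomial hA) with hB
  refine ⟨(B.repr a).filter fun m => ∀ i, m.1 i < N i, ?_, ?_⟩
  · intro m hm
    rw [Finsupp.support_filter, Finset.mem_filter] at hm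
    exact hm.2
  · have h1 : Finsupp.linearCombination F (fun m => normalMonomial x h N m.1) (B.repr a) = a := by
      have := B.linearCombination_repr a
      rwa [show ⇑B = fun m => normalMonomial x h N m.1 from
        funext (hA.basis_apply (hh.hasLeadingWord_normalMonomial hA))] at this
    rw [← Finsupp.linearCombination_apply]
    nth_rewrite 1 [← h1]
    nth_rewrite 1 [← Finsupp.filter_add_filter_not (B.repr a) fun m => ∀ i, m.1 i < N i]
    rw [map_add, add_sub_cancel_left, Finsupp.linearCombination_apply]
    refine Ideal.sum_mem _ fun m hm => ?_
    rw [Finsupp.support_filter, Finset.mem_filter] at hm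
    obtain ⟨i, hi⟩ := not_forall.1 hm.2
    simp only [Algebra.smul_def]
    exact Ideal.mul_mem_left _ _ (hh.normalMonomial_mem m.2 (not_lt.1 hi))

/-- The bilinear form `Λ(a b)` is nondegenerate on reduced elements, on both sides. -/
lemma exists_topCoord_mul_ne_zero (hA : IsPBWAlgebra F x odd)
    {l : {m : Fin n → ℕ // AdmissibleExponent odd m} →₀ F}
    (hl : ∀ m ∈ l.support, ∀ i, m.1 i < N i) (hne : l ≠ 0) :
    ∃ b, hh.topCoord hA (b * l.sum fun m c => c • normalMonomial x h N m.1) ≠ 0 ∧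
      hh.topCoord hA ((l.sum fun m c => c • normalMonomial x h N m.1) * b) ≠ 0 := by
  classical
  obtain ⟨m, hm, hmax⟩ := l.support.exists_max_image (fun m => ∑ i, m.1 i)
    (Finsupp.support_nonempty_iff.2 hne)
  -- `k` complements a term of maximal degree to the top exponent. No other term has larger degree,
  -- so each product has length at most that of the top word, and only `m` gives the right letter
  -- counts.
  let k : Fin n → ℕ := fun i => N i - 1 - m.1 i
  have hkm : ∀ i, k i + m.1 i = N i - 1 := fun i => by
    have := hl m hm i
    simp only [k]
    omega
  have hlead := hh.hasLeadingWord_normalMonomial hA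
  have hlen : ∀ m' ∈ l.support, ∑ i, k i + ∑ i, m'.1 i ≤ ∑ i, (N i - 1) := by
    intro m' hm'
    calc ∑ i, k i + ∑ i, m'.1 i ≤ ∑ i, k i + ∑ i, m.1 i := Nat.add_le_add_left (hmax m' hm') _
      _ = ∑ i, (N i - 1) := by
        rw [← Finset.sum_add_distrib]
        exact Finset.sum_congr rfl fun i _ => hkm i
  have hl' : ∀ m' ∈ l.support,
      hh.topCoord hA (normalMonomial x h N k * normalMonomial x h N m'.1) ≠ 0 ↔ m' = m := by
    intro m' hm'
    rw [hh.topCoord_ne_zero_iff hA ((hlead k).mul (hlead m'.1))]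
    · simp only [List.count_append, count_exponentWord]
      refine ⟨fun h => Subtype.ext (funext fun i => ?_), ?_⟩
      · have := h i
        have := hkm i
        omega
      · rintro rfl
        exact hkm
    · simpa only [List.length_append, length_exponentWord] using hlen m' hm'
  have hr' : ∀ m' ∈ l.support,
      hh.topCoord hA (normalMonomial x h N m'.1 * normalMonomial x h N k) ≠ 0 ↔ m' = m := by
    intro m' hm'
    rw [hh.topCoord_ne_zero_iff hA ((hlead m'.1).mul (hlead k))]
    · simp only [List.count_append, count_exponentWord]
      refine ⟨fun h => Subtype.ext (funext fun i => ?_), ?_⟩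
      · have := h i
        have := hkm i
        omega
      · rintro rfl i
        rw [add_comm, hkm]
    · simpa only [List.length_append, length_exponentWord, add_comm] using hlen m' hm'
  refine ⟨normalMonomial x h N k, ?_, ?_⟩
  · rw [Finsupp.sum, Finset.mul_sum, map_sum, Finset.sum_eq_single m]
    · rw [mul_smul_comm, map_smul]
      exact smul_ne_zero (Finsupp.mem_support_iff.1 hm) ((hl' m hm).2 rfl)
    · intro m' hm' hne'
      rw [mul_smul_comm, map_smul, not_not.1 (mt (hl' m' hm').1 hne'), smul_zero]
    · exact fun h => absurd hm h
  · rw [Finsupp.sum, Finset.sum_mul, map_sum, Finset.sum_eq_single m]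
    · rw [smul_mul_assoc, map_smul]
      exact smul_ne_zero (Finsupp.mem_support_iff.1 hm) ((hr' m hm).2 rfl)
    · intro m' hm' hne'
      rw [smul_mul_assoc, map_smul, not_not.1 (mt (hr' m' hm').1 hne'), smul_zero]
    · exact fun h => absurd hm h

/-- The quotient of a PBW algebra by a normal family has a nondegenerate associative form. -/
theorem exists_nondegenerate_form (hA : IsPBWAlgebra F x odd) {B : Type*} [Ring B] [Algebra F B]
    (π : A →ₐ[F] B) (hπ : Function.Surjective π)
    (hker : ∀ a, π a = 0 ↔ a ∈ normalIdeal odd h) :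
    ∃ f : LinearMap.BilinForm F B, f.Nondegenerate ∧ ∀ x y z, f (x * y) z = f x (y * z) := by
  obtain ⟨g, hg⟩ := π.toLinearMap.exists_rightInverse_of_surjective
    (LinearMap.range_eq_top.2 hπ)
  -- The section `g` is only linear. The choice does not matter, because the top coordinate vanishes
  -- on the kernel of `π`.
  let Λ : B →ₗ[F] F := hh.topCoord hA ∘ₗ g
  have hΛ : ∀ a, Λ (π a) = hh.topCoord hA a := by
    intro a
    have h1 : π (g (π a)) = π a := LinearMap.congr_fun hg (π a)
    have h2 : g (π a) - a ∈ normalIdeal odd h := (hker _).1 (by rw [map_sub, h1, sub_self])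
    have h3 := hh.topCoord_eq_zero_of_mem hA h2
    rw [map_sub, sub_eq_zero] at h3
    exact h3
  have key : ∀ b : B, b ≠ 0 → ∃ c, Λ (c * b) ≠ 0 ∧ Λ (b * c) ≠ 0 := by
    intro b hb
    obtain ⟨a, rfl⟩ := hπ b
    obtain ⟨l, hl, hal⟩ := hh.exists_reduced hA a
    have h1 := (hker _).2 hal
    rw [map_sub, sub_eq_zero] at h1
    have hne : l ≠ 0 := by
      rintro rfl
      exact hb (by rw [h1]; simp)
    obtain ⟨c, h2, h3⟩ := hh.exists_topCoord_mul_ne_zero hA hl hne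
    refine ⟨π c, ?_, ?_⟩
    · rwa [h1, ← map_mul, hΛ]
    · rwa [h1, ← map_mul, hΛ]
  refine ⟨(LinearMap.mul F B).compr₂ Λ, ⟨?_, ?_⟩, ?_⟩
  · intro b hb
    by_contra hne
    obtain ⟨c, -, hc⟩ := key b hne
    exact hc (hb c)
  · intro b hb
    by_contra hne
    obtain ⟨c, hc, -⟩ := key b hne
    exact hc (hb c)
  · intro a b c
    simp [mul_assoc]

end IsNormalFamily
end Normal

/-! ### Jacobson's formula -/

section Jacobson

variable {p : ℕ}

/-- By Pascal's rule adjacent entries of row p - 1 add up to an inner entry of row p, which vanishes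
in characteristic p. -/
lemma cast_choose_char_sub_one {F : Type*} [Field F] [CharP F p] (hp : p.Prime)
    {k : ℕ} (hk : k ≤ p - 1) :
    ((p - 1).choose k : F) = (-1) ^ k := by
  induction k with
  | zero => simp
  | succ k ih =>
    have h1 : (p.choose (k + 1) : F) = 0 := by
      rw [CharP.cast_eq_zero_iff F p]
      exact hp.dvd_choose_self (by omega) (by omega)
    have h2 : p.choose (k + 1) = (p - 1).choose k + (p - 1).choose (k + 1) := by
      have h3 : p = p - 1 + 1 := by have := hp.pos; omega
      conv_lhs => rw [h3]
      exact Nat.choose_succ_succ _ _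
    rw [h2, Nat.cast_add, ih (by omega)] at h1
    rw [pow_succ]
    linear_combination h1

variable {A : Type*} [Ring A]

lemma Commute.sub_pow_char_sub_one (F : Type*) [Field F] [CharP F p] [Algebra F A]
    (hp : p.Prime) (hp2 : p ≠ 2) {l r : A} (h : Commute l r) :
    (l - r) ^ (p - 1) = ∑ k ∈ Finset.range p, l ^ k * r ^ (p - 1 - k) := by
  rw [sub_eq_add_neg, h.neg_right.add_pow, Nat.sub_add_cancel hp.one_le]
  refine Finset.sum_congr rfl fun k hk => ?_
  rw [Finset.mem_range] at hk
  have h1 : (((p - 1).choose k : ℕ) : A) = algebraMap F A ((-1) ^ k) := by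
    rw [← cast_choose_char_sub_one hp (by omega), map_natCast]
  have h2 : (-1 : A) ^ (p - 1 - k) * (-1) ^ k = 1 := by
    rw [← pow_add, Nat.sub_add_cancel (by omega)]
    exact (hp.even_sub_one hp2).neg_one_pow
  rw [h1, neg_pow, map_pow, map_neg, map_one, mul_assoc, mul_assoc,
    ((Commute.neg_one_right (r ^ (p - 1 - k))).pow_right k).eq, ← mul_assoc (_ ^ _) (_ ^ k), h2,
    one_mul]

lemma Commute.sub_pow_char' (F : Type*) [Field F] [CharP F p] [Algebra F A]
    (hp : p.Prime) (hp2 : p ≠ 2) {l r : A} (h : Commute l r) :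
    (l - r) ^ p = l ^ p - r ^ p := by
  rw [← h.mul_geom_sum₂, ← h.sub_pow_char_sub_one F hp hp2, ← pow_succ',
    Nat.sub_add_cancel hp.one_le]

/-- The commutator with `P` is the difference of left and right multiplication by `P`. These
commute, so the binomial formula for the power p - 1 applies. -/
lemma iterate_commutator_char_sub_one (F : Type*) [Field F] [CharP F p] [Algebra F A]
    (hp : p.Prime) (hp2 : p ≠ 2) (P Q : A) :
    (fun Q => P * Q - Q * P)^[p - 1] Q
      = ∑ k ∈ Finset.range p, P ^ k * Q * P ^ (p - 1 - k) := by
  have h := congrArg (fun φ : Module.End F A => φ Q)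
    ((LinearMap.commute_mulLeft_right (R := F) P P).sub_pow_char_sub_one F hp hp2)
  simp only [LinearMap.sum_apply, Module.End.mul_apply, LinearMap.pow_mulLeft,
    LinearMap.pow_mulRight, LinearMap.mulLeft_apply, LinearMap.mulRight_apply,
    Module.End.pow_apply] at h
  simp only [mul_assoc]
  exact h

/-- For P = at + b, where P' = a, and m = p, this sum is the one that the iterated commutator
produces. -/
lemma derivative_pow_noncomm (P : Polynomial A) (m : ℕ) :
    Polynomial.derivative (P ^ m)
      = ∑ k ∈ Finset.range m, P ^ k * Polynomial.derivative P * P ^ (m - 1 - k) := by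
  induction m with
  | zero => simp
  | succ m ih =>
    rw [pow_succ, Polynomial.derivative_mul, ih, Finset.sum_mul, Finset.sum_range_succ]
    congr 1
    · refine Finset.sum_congr rfl fun k hk => ?_
      rw [Finset.mem_range] at hk
      rw [mul_assoc, ← pow_succ]
      congr 2
      omega
    · simp

/-- Jacobson's formula for the `p`-th power of a sum in an associative algebra. -/
theorem add_pow_char_jacobson {F : Type*} [Field F] [CharP F p] [Algebra F A]
    (hp : p.Prime) (hp2 : p ≠ 2) (a b : A) :
    (a + b) ^ p = a ^ p + b ^ p + ∑ i ∈ Finset.Icc 1 (p - 1), (i : F)⁻¹ •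
      ((fun Q => (Polynomial.C a * Polynomial.X + Polynomial.C b) * Q
        - Q * (Polynomial.C a * Polynomial.X + Polynomial.C b))^[p - 1]
          (Polynomial.C a)).coeff (i - 1) := by
  set P : Polynomial A := Polynomial.C a * Polynomial.X + Polynomial.C b with hP
  have hdeg : P.natDegree ≤ 1 := Polynomial.natDegree_linear_le
  have hder : Polynomial.derivative P = Polynomial.C a := by simp [hP]
  -- ad(P)^(p-1)(a) is the derivative of P^p, so dividing its coefficient of t^(i-1) by i recovers
  -- the coefficient of t^i in P^p. Evaluation at t = 1 then gives (a + b)^p.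
  have hit : (fun Q => P * Q - Q * P)^[p - 1] (Polynomial.C a)
      = Polynomial.derivative (P ^ p) := by
    rw [derivative_pow_noncomm, hder]
    exact iterate_commutator_char_sub_one F hp hp2 P _
  have hco : ∀ i ∈ Finset.Icc 1 (p - 1), (i : F)⁻¹ •
      ((fun Q => P * Q - Q * P)^[p - 1] (Polynomial.C a)).coeff (i - 1) = (P ^ p).coeff i := by
    intro i hi
    rw [Finset.mem_Icc] at hi
    obtain ⟨j, rfl⟩ : ∃ j, i = j + 1 := ⟨i - 1, by omega⟩
    have hne : ((j + 1 : ℕ) : F) ≠ 0 := by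
      rw [Ne, CharP.cast_eq_zero_iff F p]
      exact Nat.not_dvd_of_pos_of_lt (by omega) (by have := hp.pos; omega)
    rw [hit, Nat.add_sub_cancel, Polynomial.coeff_derivative]
    have : (P ^ p).coeff (j + 1) * ((j : A) + 1)
        = ((j + 1 : ℕ) : F) • (P ^ p).coeff (j + 1) := by
      rw [Algebra.smul_def, map_natCast, ← Nat.cast_succ]
      exact (Nat.cast_commute _ _).symm.eq
    rw [this, smul_smul, inv_mul_cancel₀ hne, one_smul]
  rw [Finset.sum_congr rfl hco]
  -- Over a noncommutative ring evaluation is multiplicative here because 1 is central.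
  have hev : (P ^ p).eval 1 = (a + b) ^ p := by
    have := map_pow (Polynomial.eval₂RingHom' (RingHom.id A) 1 fun a => Commute.one_right a) P p
    have h1 : ∀ Q : Polynomial A, Polynomial.eval₂RingHom' (RingHom.id A) 1
        (fun a => Commute.one_right a) Q = Q.eval 1 := fun Q => rfl
    rw [h1, h1] at this
    rw [this]
    simp [hP]
  have hdeg' : (P ^ p).natDegree < p + 1 := by
    have := Polynomial.natDegree_pow_le_of_le p hdeg
    omega
  rw [← hev, Polynomial.eval_eq_sum_range' hdeg']
  simp only [one_pow, mul_one]
  have h0 : (P ^ p).coeff 0 = b ^ p := by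
    have := map_pow (Polynomial.constantCoeff (R := A)) P p
    simpa [hP] using this
  have htop : (P ^ p).coeff p = a ^ p := by
    have := Polynomial.coeff_pow_of_natDegree_le (m := p) hdeg
    rw [mul_one] at this
    rw [this]
    simp [hP]
  rw [Finset.sum_range_succ, htop, Finset.range_eq_Ico, Finset.sum_eq_sum_Ico_succ_bot hp.pos, h0]
  have : Finset.Ico (0 + 1) p = Finset.Icc 1 (p - 1) := by
    ext i
    simp only [Finset.mem_Ico, Finset.mem_Icc]
    have := hp.pos
    omega
  rw [this]
  abel

end Jacobson

namespace LieColor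

/-! ### The elements x^p - x^[p] of the enveloping algebra. -/

section Restricted

variable {Γ : Type*} {F : Type*} [AddCommGroup Γ] [Field F]

lemma Bicharacter.coe_nsmul_left (ε : Bicharacter Γ F) (k : ℕ) (α β : Γ) :
    (ε (k • α) β : F) = (ε α β : F) ^ k := by
  induction k with
  | zero =>
    have h := ε.coe_add_left 0 0 β
    rw [add_zero] at h
    rw [zero_smul, pow_zero]
    exact (mul_eq_left₀ (Units.ne_zero (ε 0 β))).1 h.symm
  | succ k ih => rw [succ_nsmul, ε.coe_add_left, ih, pow_succ]

lemma Bicharacter.coe_nsmul_right (ε : Bicharacter Γ F) (k : ℕ) (α β : Γ) :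
    (ε α (k • β) : F) = (ε α β : F) ^ k := by
  induction k with
  | zero =>
    have h := ε.coe_add_right α 0 0
    rw [add_zero] at h
    rw [zero_smul, pow_zero]
    exact (mul_eq_left₀ (Units.ne_zero (ε α 0))).1 h.symm
  | succ k ih => rw [succ_nsmul, ε.coe_add_right, ih, pow_succ]

variable {p : ℕ} [DecidableEq Γ] {ε : Bicharacter Γ F} {𝔤 : Type*} [AddCommGroup 𝔤]
  [Module F 𝔤] (L : RestrictedLieColorAlgebra p ε 𝔤)

namespace RestrictedLieColorAlgebra

lemma envι_mul {α β : Γ} {x y : 𝔤} (hx : x ∈ L.grade α) (hy : y ∈ L.grade β) :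
    L.envι x * L.envι y
      = (ε α β : F) • (L.envι y * L.envι x) + L.envι (L.bracket x y) := by
  rw [← sub_eq_iff_eq_add']
  exact PCharacter.env_comm (L := L) (⟨x, hx⟩ : L.grade α) (⟨y, hy⟩ : L.grade β)

/-- The coefficients of the iterates of `ad (t x + y)` in the enveloping algebra. -/
lemma coeff_iterate_adPoly {α : Γ} (hα : ε.IsEven α) {x y : 𝔤} (hx : x ∈ L.grade α)
    (hy : y ∈ L.grade α) (k : ℕ) :
    (∀ i, ((L.adPoly x y)^[k] (PolynomialModule.single F 0 x)).coeff i ∈ L.grade ((k + 1) • α)) ∧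
    ∀ i, L.envι (((L.adPoly x y)^[k] (PolynomialModule.single F 0 x)).coeff i) =
      ((fun Q => (Polynomial.C (L.envι x) * Polynomial.X + Polynomial.C (L.envι y)) * Q
        - Q * (Polynomial.C (L.envι x) * Polynomial.X + Polynomial.C (L.envι y)))^[k]
          (Polynomial.C (L.envι x))).coeff i := by
  induction k with
  | zero =>
    constructor
    · intro i
      simp only [Function.iterate_zero, id, PolynomialModule.coeff_single, zero_add, one_smul]
      rw [Finsupp.single_apply]
      split_ifs
      · exact hx
      · exact zero_mem _
    · intro i
      simp only [Function.iterate_zero, id, PolynomialModule.coeff_single]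
      rw [Finsupp.single_apply, Polynomial.coeff_C]
      by_cases h : i = 0
      · simp [h]
      · rw [if_neg h, if_neg (Ne.symm h), map_zero]
  | succ k ih =>
    obtain ⟨ih1, ih2⟩ := ih
    simp only [Function.iterate_succ_apply']
    set q := (L.adPoly x y)^[k] (PolynomialModule.single F 0 x)
    set Q := ((fun Q => (Polynomial.C (L.envι x) * Polynomial.X + Polynomial.C (L.envι y)) * Q
        - Q * (Polynomial.C (L.envι x) * Polynomial.X + Polynomial.C (L.envι y)))^[k]
          (Polynomial.C (L.envι x)))
    -- Since α is even it pairs trivially with its multiples, so on all elements that occur here the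
    -- color commutator is the ordinary one.
    have hε : (ε α ((k + 1) • α) : F) = 1 := by
      rw [ε.coe_nsmul_right, show ε α α = 1 from hα, Units.val_one, one_pow]
    have hmap : ∀ (f : 𝔤 →ₗ[F] 𝔤) (i : ℕ), (PolynomialModule.map F f q).coeff i = f (q.coeff i) :=
      fun f i => rfl
    have hcomm : ∀ {z : 𝔤}, z ∈ L.grade α → ∀ i,
        L.envι z * Q.coeff i - Q.coeff i * L.envι z = L.envι (L.bracket z (q.coeff i)) := by
      intro z hz i
      rw [← ih2, L.envι_mul hz (ih1 i), hε, one_smul, add_sub_cancel_left]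
    have hzero : (L.adPoly x y q).coeff 0 = L.bracket y (q.coeff 0) := by
      simp only [LieColorAlgebra.adPoly, ← Polynomial.monomial_one_one_eq_X,
        PolynomialModule.coeff_add, Finsupp.add_apply, PolynomialModule.monomial_smul_apply, hmap]
      simp
    have hsucc : ∀ i, (L.adPoly x y q).coeff (i + 1)
        = L.bracket x (q.coeff i) + L.bracket y (q.coeff (i + 1)) := by
      intro i
      simp only [LieColorAlgebra.adPoly, ← Polynomial.monomial_one_one_eq_X,
        PolynomialModule.coeff_add, Finsupp.add_apply, PolynomialModule.monomial_smul_apply, hmap]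
      simp
    constructor
    · intro i
      rw [succ_nsmul']
      cases i with
      | zero => rw [hzero]; exact L.bracket_mem hy (ih1 0)
      | succ i =>
        rw [hsucc]; exact add_mem (L.bracket_mem hx (ih1 i)) (L.bracket_mem hy (ih1 (i + 1)))
    · intro i
      cases i with
      | zero =>
        rw [hzero, ← hcomm hy]
        simp [add_mul, mul_add, ← mul_assoc]
      | succ i =>
        rw [hsucc, map_add, ← hcomm hx, ← hcomm hy]
        have h1 : ∀ a : L.Env, (Polynomial.C a * Polynomial.X * Q).coeff (i + 1) = a * Q.coeff i := by
          intro a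
          rw [mul_assoc, Polynomial.X_mul, ← mul_assoc, Polynomial.coeff_mul_X,
            Polynomial.coeff_C_mul]
        have h2 : ∀ a : L.Env,
            (Q * (Polynomial.C a * Polynomial.X)).coeff (i + 1) = Q.coeff i * a := by
          intro a
          rw [← mul_assoc, Polynomial.coeff_mul_X, Polynomial.coeff_mul_C]
        simp only [add_mul, mul_add, Polynomial.coeff_sub, Polynomial.coeff_add, h1, h2,
          Polynomial.coeff_C_mul, Polynomial.coeff_mul_C]
        abel

lemma pDiff_smul {α : Γ} (hα : ε.IsEven α) (c : F) (x : L.grade α) :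
    L.pDiff α hα (c • x) = c ^ p • L.pDiff α hα x := by
  rw [pDiff, L.pMap_smul, Submodule.coe_smul, Submodule.coe_smul, map_smul, map_smul, pDiff,
    smul_sub, smul_pow]

variable [CharP F p] (hp : p.Prime) (hp2 : p ≠ 2)
include hp hp2

lemma envι_add_pow {α : Γ} (hα : ε.IsEven α) {x y : 𝔤} (hx : x ∈ L.grade α)
    (hy : y ∈ L.grade α) : L.envι (x + y) ^ p = L.envι x ^ p + L.envι y ^ p
      + ∑ i ∈ Finset.Icc 1 (p - 1), L.envι (L.s p i x y) := by
  rw [map_add, add_pow_char_jacobson (F := F) hp hp2]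
  congr 1
  refine Finset.sum_congr rfl fun i _ => ?_
  rw [LieColorAlgebra.s, map_smul, (L.coeff_iterate_adPoly hα hx hy (p - 1)).2]

/-- Jacobson's formula in U(𝔤) and the axiom for (x + y)^[p] have the same correction terms s_i.
Together with `pDiff_smul` this makes x ↦ x^p - x^[p] p-semilinear. -/
lemma pDiff_add {α : Γ} (hα : ε.IsEven α) (x y : L.grade α) :
    L.pDiff α hα (x + y) = L.pDiff α hα x + L.pDiff α hα y := by
  rw [pDiff, L.pMap_add, Submodule.coe_add, L.envι_add_pow hp hp2 hα x.2 y.2]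
  simp only [pDiff, map_add, map_sum]
  abel

/-- The elements `x^p - x^[p]` commute with homogeneous elements up to scalars. -/
lemma pDiff_mul_envι {α β : Γ} (hα : ε.IsEven α) (x : L.grade α) {y : 𝔤} (hy : y ∈ L.grade β) :
    L.pDiff α hα x * L.envι y = (ε (p • α) β : F) • (L.envι y * L.pDiff α hα x) := by
  -- Along the orbit of `y` the scalar stays `ε α β`, because `ε α (k • α + β) = ε α β`. So ad x
  -- acts there as l - ε(α, β) r with l and r the left and right multiplication, and its p-th power
  -- is l^p - ε(pα, β) r^p.
  have hiter : ∀ k, (fun y => L.bracket (x : 𝔤) y)^[k] y ∈ L.grade (k • α + β) ∧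
      L.envι ((fun y => L.bracket (x : 𝔤) y)^[k] y) =
        ((LinearMap.mulLeft F (L.envι (x : 𝔤))
          - (ε α β : F) • LinearMap.mulRight F (L.envι (x : 𝔤))) ^ k) (L.envι y) := by
    intro k
    induction k with
    | zero => simpa using hy
    | succ k ih =>
      rw [Function.iterate_succ_apply', pow_succ', Module.End.mul_apply, ← ih.2]
      refine ⟨?_, ?_⟩
      · rw [succ_nsmul', add_assoc]
        exact L.bracket_mem x.2 ih.1
      · have h1 := L.envι_mul x.2 ih.1
        have h2 : (ε α (k • α + β) : F) = ε α β := by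
          rw [ε.coe_add_right, ε.coe_nsmul_right, show ε α α = 1 from hα, Units.val_one, one_pow,
            one_mul]
        rw [h2] at h1
        rw [LinearMap.sub_apply, LinearMap.smul_apply, LinearMap.mulLeft_apply,
          LinearMap.mulRight_apply, h1, add_sub_cancel_left]
  have h1 := (hiter p).2
  have hc : Commute (LinearMap.mulLeft F (L.envι (x : 𝔤)))
      ((ε α β : F) • LinearMap.mulRight F (L.envι (x : 𝔤))) :=
    (LinearMap.commute_mulLeft_right (R := F) _ _).smul_right _
  rw [← L.ad_pMap α hα, hc.sub_pow_char' F hp hp2, smul_pow, LinearMap.sub_apply,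
    LinearMap.smul_apply, LinearMap.pow_mulLeft, LinearMap.pow_mulRight, LinearMap.mulLeft_apply,
    LinearMap.mulRight_apply, ← ε.coe_nsmul_left] at h1
  have h2 := L.envι_mul (L.pMap α hα x).2 hy
  rw [pDiff, sub_mul, mul_sub, smul_sub, h2, h1]
  abel

end RestrictedLieColorAlgebra
end Restricted
end LieColor

/-! ### Adapted bases -/

/-- The space is the direct sum of the line through ξ and the kernel of c. -/
lemma exists_basis_ker_or_eq {F V : Type*} [Field F] [AddCommGroup V] [Module F V]
    [FiniteDimensional F V] (ξ : V) (c : Dual F V) (h : c ξ = 1) :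
    ∃ (k : ℕ) (b : Basis (Fin k) F V), ∀ i, c (b i) = 0 ∨ b i = ξ := by
  refine ⟨_, Basis.mkFinCons ξ (finBasis F (LinearMap.ker c)) ?_ ?_, ?_⟩
  · intro r x hx hr
    have := congrArg c hr
    rw [map_add, map_smul, h, LinearMap.mem_ker.1 hx] at this
    simpa using this
  · intro z
    refine ⟨-c z, ?_⟩
    rw [LinearMap.mem_ker, map_add, map_smul, h]
    simp
  · intro i
    rw [Basis.coe_mkFinCons]
    refine Fin.cases (Or.inr rfl) (fun j => Or.inl ?_) i
    exact LinearMap.mem_ker.1 (finBasis F (LinearMap.ker c) j).2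

lemma pow_sub_pow_mem_wordFiltration {F A : Type*} [Field F] [Ring A] [Algebra F A] {n : ℕ}
    {x : Fin n → A} {a : A} {i : Fin n} {k : ℕ} (h : a - x i ^ k ∈ wordFiltration F x k) (m : ℕ) :
    a ^ m - x i ^ (k * m) ∈ wordFiltration F x (k * m) := by
  have ha := (hasLeadingWord_of_sub_pow_mem h).mem
  rw [List.length_replicate] at ha
  induction m with
  | zero => simp
  | succ m ih =>
    have hx : x i ^ (k * m) ∈ wordFiltration F x (k * m + 1) := by
      have := wordProd_mem_wordFiltration (F := F) (x := x) (w := List.replicate (k * m) i)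
        (k := k * m + 1) (by simp)
      simpa [wordProd] using this
    have h1 := mul_mem_wordFiltration (m := k * (m + 1)) (by rw [Nat.mul_succ]; omega) ih ha
    have h2 := mul_mem_wordFiltration (m := k * (m + 1)) (by rw [Nat.mul_succ]; omega) hx h
    convert add_mem h1 h2 using 1
    rw [pow_succ, Nat.mul_succ, pow_add, sub_mul, mul_sub]
    abel

namespace LieColor

section Assembly

variable {Γ : Type*} {F : Type*} [AddCommGroup Γ] [DecidableEq Γ] [Field F] {p : ℕ}
  {ε : Bicharacter Γ F} {𝔤 : Type*} [AddCommGroup 𝔤] [Module F 𝔤]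
  {L : RestrictedLieColorAlgebra p ε 𝔤} (χ : PCharacter L)

/-- Where χ_α = [ξ, c], every basis vector either is ξ, which carries the relation of exponent s, or
lies in ker c, where the relation reads x^p = x^[p]. `Quotient.out` fixes one representative per
class. -/
lemma PCharacter.exists_adapted_basis [FiniteDimensional F 𝔤] :
    ∃ (n : ℕ) (e : Basis (Fin n) F 𝔤) (d : Fin n → Γ) (he : ∀ i, e i ∈ L.grade (d i)),
      ∀ i (hα : ε.IsEven (d i)) (q : L.CharClass p (d i)), χ.toFun (d i) hα = Sum.inr q →
        (Quotient.out q).1.2 ⟨e i, he i⟩ = 0 ∨ ⟨e i, he i⟩ = (Quotient.out q).1.1 := by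
  have h : ∀ α, ∃ (k : ℕ) (b : Basis (Fin k) F (L.grade α)), ∀ (hα : ε.IsEven α)
      (q : L.CharClass p α), χ.toFun α hα = Sum.inr q → ∀ i,
        (Quotient.out q).1.2 (b i) = 0 ∨ b i = (Quotient.out q).1.1 := by
    intro α
    by_cases hex : ∃ (hα : ε.IsEven α) (q : L.CharClass p α), χ.toFun α hα = Sum.inr q
    · obtain ⟨hα, q, hq⟩ := hex
      obtain ⟨k, b, hb⟩ := exists_basis_ker_or_eq (Quotient.out q).1.1 (Quotient.out q).1.2
        (Quotient.out q).2
      refine ⟨k, b, fun _ q' hq' => ?_⟩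
      obtain rfl : q = q' := Sum.inr.inj (hq.symm.trans hq')
      exact hb
    · exact ⟨_, finBasis F (L.grade α), fun hα q hq => absurd ⟨hα, q, hq⟩ hex⟩
  choose k b hb using h
  let B := L.isInternal.collectedBasis b
  have hB : ∀ a, B a = (b a.1 a.2 : 𝔤) := fun a =>
    congrFun (L.isInternal.collectedBasis_coe b) a
  -- The group Γ may be infinite; finiteness of the index set comes from the dimension of 𝔤.
  have hfin : Finite (Σ α, Fin (k α)) := Module.Finite.finite_basis B
  obtain ⟨n, ⟨φ⟩⟩ := Finite.exists_equiv_fin (Σ α, Fin (k α))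
  have hBφ : ∀ i, B.reindex φ i = (b (φ.symm i).1 (φ.symm i).2 : 𝔤) := fun i => by
    rw [Basis.reindex_apply, hB]
  refine ⟨n, B.reindex φ, fun i => (φ.symm i).1, fun i => ?_, fun i hα q hq => ?_⟩
  · rw [hBφ]
    exact (b (φ.symm i).1 (φ.symm i).2).2
  · simp only [hBφ]
    exact hb _ hα q hq _

/-- The element of `U(𝔤)` with the leading term `x ^ N` that the `p`-character assigns to a
homogeneous element `x`, and its degree `N`. -/
inductive PCharacter.NormalElement : (α : Γ) → L.grade α → L.Env → ℕ → Prop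
  | odd {α : Γ} (hα : ¬ ε.IsEven α) (x : L.grade α) :
    NormalElement α x (L.envι (x : 𝔤) ^ 2) 2
  | linear {α : Γ} (hα : ε.IsEven α) {l : Dual F (L.grade α)} (h : χ.toFun α hα = Sum.inl l)
      (x : L.grade α) :
    NormalElement α x (L.pDiff α hα x - algebraMap F L.Env (l x ^ p)) p
  | proportional {α : Γ} (hα : ε.IsEven α) {q : L.CharClass p α} (h : χ.toFun α hα = Sum.inr q)
      {x : L.grade α} (hx : (Quotient.out q).1.2 x = 0) :
    NormalElement α x (L.pDiff α hα x) p
  | root {α : Γ} (hα : ε.IsEven α) {q : L.CharClass p α} (h : χ.toFun α hα = Sum.inr q) :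
    NormalElement α (Quotient.out q).1.1
      (L.pDiff α hα (Quotient.out q).1.1 ^ addOrderOf (p • α) - 1) (p * addOrderOf (p • α))

/-! ### Normal elements and their commutation rules. -/

namespace PCharacter

variable {χ}

lemma addOrderOf_pos_of_eq_inr {α : Γ} {hα : ε.IsEven α} {q : L.CharClass p α}
    (h : χ.toFun α hα = Sum.inr q) : 0 < addOrderOf (p • α) := by
  rw [addOrderOf_pos_iff]
  by_contra hf
  have := χ.of_infinite α hα fun hh => hf hh.nsmul
  rw [h] at this
  cases this

lemma eq_zero_of_eq_inl {α : Γ} {hα : ε.IsEven α} {l : Dual F (L.grade α)}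
    (h : χ.toFun α hα = Sum.inl l) (h0 : p • α ≠ 0) : l = 0 := by
  by_cases hf : IsOfFinAddOrder (p • α)
  · rcases χ.of_finite α hα h0 hf with h' | ⟨q, h'⟩ <;> rw [h] at h'
    · exact Sum.inl.inj h'
    · cases h'
  · have h' := χ.of_infinite α hα (fun hh => hf hh.nsmul)
    rw [h] at h'
    exact Sum.inl.inj h'

namespace NormalElement

variable {α : Γ} {x : L.grade α} {h : L.Env} {N : ℕ}

lemma pos (hp : 0 < p) (H : NormalElement χ α x h N) : 0 < N := by
  cases H with
  | odd => exact two_pos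
  | linear => exact hp
  | proportional => exact hp
  | root hα hq => exact Nat.mul_pos hp (addOrderOf_pos_of_eq_inr hq)

lemma eq_two (H : NormalElement χ α x h N) (hα : ¬ ε.IsEven α) : N = 2 := by
  cases H with
  | odd => rfl
  | linear hα' => exact absurd hα' hα
  | proportional hα' => exact absurd hα' hα
  | root hα' => exact absurd hα' hα

lemma eq_of_inl (H : NormalElement χ α x h N) {hα : ε.IsEven α} {l : Dual F (L.grade α)}
    (hl : χ.toFun α hα = Sum.inl l) :
    h = L.pDiff α hα x - algebraMap F L.Env (l x ^ p) := by
  cases H with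
  | odd hα' => exact absurd hα hα'
  | linear hα' hl' => rw [Sum.inl.inj (hl.symm.trans hl')]
  | proportional hα' hq => exact absurd (hl.symm.trans hq) (by simp)
  | root hα' hq => exact absurd (hl.symm.trans hq) (by simp)

lemma eq_of_inr (H : NormalElement χ α x h N) {hα : ε.IsEven α} {q : L.CharClass p α}
    (hq : χ.toFun α hα = Sum.inr q) :
    ((Quotient.out q).1.2 x = 0 ∧ h = L.pDiff α hα x) ∨
      (x = (Quotient.out q).1.1 ∧ h = L.pDiff α hα x ^ addOrderOf (p • α) - 1) := by
  cases H with
  | odd hα' => exact absurd hα hα'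
  | linear hα' hl' => exact absurd (hq.symm.trans hl') (by simp)
  | proportional hα' hq' hx =>
    obtain rfl := Sum.inr.inj (hq.symm.trans hq')
    exact Or.inl ⟨hx, rfl⟩
  | root hα' hq' =>
    obtain rfl := Sum.inr.inj (hq.symm.trans hq')
    exact Or.inr ⟨rfl, rfl⟩

lemma quot_eq_zero (hp : p ≠ 0) (H : NormalElement χ α x h N) (hα : ε.IsEven α) :
    χ.quot h = 0 := by
  cases H with
  | odd hα' => exact absurd hα hα'
  | linear hα' hl =>
    rw [map_sub, sub_eq_zero]
    exact χ.quot_rel (RedRel.linear hl x)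
  | @proportional hα' q hq _ hx =>
    have := χ.quot_rel (RedRel.proportional (q := Quotient.out q)
      (hq.trans (congrArg Sum.inr (Quotient.out_eq q).symm)) x)
    rwa [hx, zero_pow hp, zero_smul, map_zero] at this
  | @root hα' q hq =>
    have := χ.quot_rel (RedRel.root (q := Quotient.out q)
      (hq.trans (congrArg Sum.inr (Quotient.out_eq q).symm)))
    rw [map_sub, sub_eq_zero]
    exact this

/-- A normal element commutes with homogeneous elements of `𝔤` up to the values of a character. -/
lemma exists_mul_envι [CharP F p] (hp : p.Prime) (hp2 : p ≠ 2) (H : NormalElement χ α x h N)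
    (hα : ε.IsEven α) : ∃ δ : Γ, ∀ {β : Γ} {y : 𝔤}, y ∈ L.grade β →
      h * L.envι y = (ε δ β : F) • (L.envι y * h) := by
  cases H with
  | odd hα' => exact absurd hα hα'
  | @linear hα' l hl =>
    refine ⟨p • α, fun {β y} hy => ?_⟩
    rw [sub_mul, mul_sub, L.pDiff_mul_envι hp hp2 hα' x hy, smul_sub]
    congr 1
    -- The constant commutes without a scalar. This is consistent because the constant is zero
    -- unless pα = 0, in which case the scalar is 1.
    by_cases h0 : p • α = 0
    · have : (ε (0 : Γ) β : F) = 1 := by simpa using ε.coe_nsmul_left 0 0 β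
      rw [h0, this, one_smul, Algebra.commutes]
    · rw [eq_zero_of_eq_inl hl h0, LinearMap.zero_apply, zero_pow hp.ne_zero, map_zero, zero_mul,
        mul_zero, smul_zero]
  | proportional hα' hq hx => exact ⟨p • α, fun {β y} hy => L.pDiff_mul_envι hp hp2 hα' x hy⟩
  | @root hα' q hq =>
    -- The s-th power has degree s·pα = 0, so it commutes with 𝔤 exactly, as does the constant 1.
    refine ⟨0, fun {β y} hy => ?_⟩
    have h1 : (ε (0 : Γ) β : F) = 1 := by simpa using ε.coe_nsmul_left 0 0 β
    have h2 : ∀ k : ℕ, L.pDiff α hα' (Quotient.out q).1.1 ^ k * L.envι y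
        = (ε (p • α) β : F) ^ k • (L.envι y * L.pDiff α hα' (Quotient.out q).1.1 ^ k) := by
      intro k
      induction k with
      | zero => simp
      | succ k ih =>
        rw [pow_succ, mul_assoc, L.pDiff_mul_envι hp hp2 hα' _ hy, mul_smul_comm, ← mul_assoc, ih,
          smul_mul_assoc, smul_smul, mul_assoc, pow_succ']
    rw [h1, one_smul, sub_mul, mul_sub, h2, ← ε.coe_nsmul_left, addOrderOf_nsmul_eq_zero, h1,
      one_smul, one_mul, mul_one]

/-- If an element commutes with homogeneous elements of `𝔤` up to the values of a character, then
it commutes with normal elements up to scalars. -/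
lemma exists_mul_comm (hp : p ≠ 0) (H : NormalElement χ α x h N) {a : L.Env} {δ : Γ}
    (ha : ∀ {β : Γ} {y : 𝔤}, y ∈ L.grade β → a * L.envι y = (ε δ β : F) • (L.envι y * a)) :
    ∃ c : F, a * h = c • (h * a) := by
  have hpow : ∀ {u : L.Env} {β : Γ}, a * u = (ε δ β : F) • (u * a) → ∀ k : ℕ,
      a * u ^ k = (ε δ (k • β) : F) • (u ^ k * a) := by
    intro u β hu k
    rw [ε.coe_nsmul_right]
    induction k with
    | zero => simp
    | succ k ih =>
      rw [pow_succ, ← mul_assoc, ih, smul_mul_assoc, mul_assoc, hu, mul_smul_comm, smul_smul,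
        ← mul_assoc, pow_succ]
  have h0 : (ε δ (0 : Γ) : F) = 1 := by simpa using ε.coe_nsmul_right 0 δ 0
  -- Both x^p and x^[p] have degree pα, so the same scalar appears for the two terms.
  have hz : ∀ (hα : ε.IsEven α) (x : L.grade α),
      a * L.pDiff α hα x = (ε δ (p • α) : F) • (L.pDiff α hα x * a) := by
    intro hα x
    rw [RestrictedLieColorAlgebra.pDiff, mul_sub, sub_mul, hpow (ha x.2), ha (L.pMap α hα x).2,
      smul_sub]
  cases H with
  | odd hα' => exact ⟨_, hpow (ha x.2) 2⟩
  | @linear hα' l hl =>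
    refine ⟨(ε δ (p • α) : F), ?_⟩
    rw [sub_mul, mul_sub, hz, smul_sub]
    congr 1
    by_cases hp0 : p • α = 0
    · rw [hp0, h0, one_smul, Algebra.commutes]
    · rw [eq_zero_of_eq_inl hl hp0, LinearMap.zero_apply, zero_pow hp, map_zero, zero_mul,
        mul_zero, smul_zero]
  | proportional hα' hq hx => exact ⟨_, hz hα' x⟩
  | @root hα' q hq =>
    refine ⟨1, ?_⟩
    rw [sub_mul, mul_sub, hpow (hz hα' _), addOrderOf_nsmul_eq_zero, h0, one_smul, one_mul, mul_one,
      one_smul]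

end NormalElement
end PCharacter
end Assembly

/-! ### PBW structure of U(𝔤) and leading terms of normal elements. -/

section Assembly

variable {Γ : Type*} {F : Type*} [AddCommGroup Γ] [DecidableEq Γ] [Field F] {p : ℕ}
  {ε : Bicharacter Γ F} {𝔤 : Type*} [AddCommGroup 𝔤] [Module F 𝔤]
  {L : RestrictedLieColorAlgebra p ε 𝔤} {χ : PCharacter L}
  {n : ℕ} {d : Fin n → Γ} {e : Basis (Fin n) F 𝔤}

lemma envι_mem_wordFiltration (x : 𝔤) {k : ℕ} (hk : 2 ≤ k) :
    L.envι x ∈ wordFiltration F (fun i => L.envι (e i)) k := by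
  rw [← e.sum_repr x, map_sum]
  refine Submodule.sum_mem _ fun i _ => ?_
  rw [map_smul]
  refine Submodule.smul_mem _ _ ?_
  have := wordProd_mem_wordFiltration (F := F) (x := fun i => L.envι (e i)) (w := [i]) (k := k)
    (by simp; omega)
  simpa [wordProd] using this

lemma one_mem_wordFiltration (x : Fin n → L.Env) {k : ℕ} (hk : 0 < k) :
    1 ∈ wordFiltration F x k := by
  have := wordProd_mem_wordFiltration (F := F) (x := x) (w := []) (k := k) (by simpa)
  simpa [wordProd] using this

/-- The Poincaré–Birkhoff–Witt theorem for Lie color algebras. -/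
theorem isPBWAlgebra_env (h2 : (2 : F) ≠ 0) (h3 : (3 : F) ≠ 0)
    (he : ∀ i, e i ∈ L.grade (d i)) :
    IsPBWAlgebra F (fun i => L.envι (e i)) fun i => ¬ ε.IsEven (d i) where
  swap i j := by
    refine ⟨ε (d i) (d j), Units.ne_zero _, ?_⟩
    rw [L.envι_mul (he i) (he j), add_sub_cancel_left]
    exact envι_mem_wordFiltration _ le_rfl
  sq i hi := by
    have h := L.envι_mul (he i) (he i)
    rw [ε.coe_self_of_not_isEven hi, neg_one_smul, eq_neg_add_iff_add_eq, ← two_smul F] at h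
    rw [← Submodule.smul_mem_iff _ h2, h]
    exact envι_mem_wordFiltration _ le_rfl
  linearIndependent := by
    let f : {w : List (Fin n) // w.Pairwise fun i j => i < j ∨ (i = j ∧ ¬ ¬ ε.IsEven (d i))} →
        {w : List (Fin n) // NormalWord ε d w} :=
      fun w => ⟨w.1, w.2.imp fun h => h.imp_right fun h => ⟨h.1, not_not.1 h.2⟩⟩
    have hf : Function.Injective f := fun w w' h => by
      have h' : (f w).1 = (f w').1 := congrArg (fun u => u.1) h
      exact Subtype.ext h'
    exact (LieColorAlgebra.linearIndependent_envWord h2 h3 he).comp f hf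
  span := LieColorAlgebra.span_envWord

lemma PCharacter.NormalElement.sub_pow_mem (hp : p.Prime) {α : Γ} {x : L.grade α} {h : L.Env}
    {N : ℕ} (H : PCharacter.NormalElement χ α x h N) {i : Fin n} (hx : (x : 𝔤) = e i) :
    h - L.envι (e i) ^ N ∈ wordFiltration F (fun i => L.envι (e i)) N := by
  have hz : ∀ (hα : ε.IsEven α), L.pDiff α hα x - L.envι (e i) ^ p
      ∈ wordFiltration F (fun i => L.envι (e i)) p := by
    intro hα
    rw [RestrictedLieColorAlgebra.pDiff, hx, sub_sub_cancel_left]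
    exact neg_mem (envι_mem_wordFiltration _ hp.two_le)
  cases H with
  | odd hα => rw [hx, sub_self]; exact zero_mem _
  | linear hα hl =>
    rw [sub_right_comm, Algebra.algebraMap_eq_smul_one]
    exact sub_mem (hz hα) (Submodule.smul_mem _ _ (one_mem_wordFiltration _ hp.pos))
  | proportional hα hq => exact hz hα
  | root hα hq =>
    rw [sub_right_comm]
    exact sub_mem (pow_sub_pow_mem_wordFiltration (x := fun i => L.envι (e i)) (hz hα) _)
      (one_mem_wordFiltration _ (Nat.mul_pos hp.pos (PCharacter.addOrderOf_pos_of_eq_inr hq)))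

/-- A `p`-semilinear map on a component takes values in a subspace if it does so on a homogeneous
basis. -/
lemma apply_mem_of_basis {M : Type*} [AddCommGroup M] [Module F M] (I : Submodule F M)
    (he : ∀ i, e i ∈ L.grade (d i)) {α : Γ} {φ : L.grade α → M}
    (hadd : ∀ x y, φ (x + y) = φ x + φ y) (hsmul : ∀ (c : F) x, φ (c • x) = c ^ p • φ x)
    (hb : ∀ x : L.grade α, (∃ i, d i = α ∧ (x : 𝔤) = e i) → φ x ∈ I) (x : L.grade α) :
    φ x ∈ I := by
  have hle : Submodule.span F (e '' {i | d i = α}) ≤ L.grade α := by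
    rw [Submodule.span_le]
    rintro _ ⟨i, rfl, rfl⟩
    exact he i
  obtain ⟨x, hx⟩ := x
  have hs := LieColorAlgebra.span_grade he hx
  induction hs using Submodule.span_induction with
  | mem x h =>
    obtain ⟨i, hi, rfl⟩ := h
    exact hb _ ⟨i, hi, rfl⟩
  | zero =>
    have h0 := hadd 0 0
    rw [add_zero, left_eq_add] at h0
    change φ 0 ∈ I
    rw [h0]
    exact zero_mem _
  | add x y hx' hy' ihx ihy =>
    have := hadd ⟨x, hle hx'⟩ ⟨y, hle hy'⟩
    change φ (⟨x, hle hx'⟩ + ⟨y, hle hy'⟩) ∈ I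
    rw [this]
    exact add_mem (ihx _) (ihy _)
  | smul c x hx' ih =>
    have := hsmul c ⟨x, hle hx'⟩
    change φ (c • ⟨x, hle hx'⟩) ∈ I
    rw [this]
    exact Submodule.smul_mem _ _ (ih _)

/-! ### The kernel of U(𝔤) → u_χ(𝔤). -/

section Kernel

variable [CharP F p] (hp : p.Prime) (hp2 : p ≠ 2) {he : ∀ i, e i ∈ L.grade (d i)}
  {h : Fin n → L.Env} {N : Fin n → ℕ}
  (H : ∀ i, PCharacter.NormalElement χ (d i) ⟨e i, he i⟩ (h i) (N i))
include hp hp2 H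

/-- The expression is p-semilinear in x, and on basis vectors of degree α it is one of the
generators `h i`. -/
lemma pDiff_sub_mem_of_inl {α : Γ} {hα : ε.IsEven α} {l : Dual F (L.grade α)}
    (hl : χ.toFun α hα = Sum.inl l) (x : L.grade α) :
    L.pDiff α hα x - algebraMap F L.Env (l x ^ p)
      ∈ normalIdeal (fun i => ¬ ε.IsEven (d i)) h := by
  have : Fact p.Prime := ⟨hp⟩
  refine apply_mem_of_basis ((normalIdeal (fun i => ¬ ε.IsEven (d i)) h).restrictScalars F) he
    (φ := fun x => L.pDiff α hα x - algebraMap F L.Env (l x ^ p)) ?_ ?_ ?_ x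
  · intro x y
    rw [L.pDiff_add hp hp2, map_add, add_pow_char, map_add]
    abel
  · intro c x
    rw [L.pDiff_smul, map_smul, smul_eq_mul, mul_pow, smul_sub, map_mul,
      Algebra.smul_def (c ^ p) (algebraMap F L.Env _)]
  · rintro ⟨_, _⟩ ⟨i, rfl, rfl⟩
    have := (H i).eq_of_inl hl
    rw [Submodule.restrictScalars_mem]
    change L.pDiff (d i) hα ⟨e i, he i⟩ - algebraMap F L.Env (l ⟨e i, he i⟩ ^ p) ∈ _
    rw [← this]
    exact mem_normalIdeal (not_not.2 hα)

/-- Again p-semilinear in x: on a basis vector in ker c it is a generator, and at ξ it is zero. -/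
lemma pDiff_sub_mem_of_inr {α : Γ} {hα : ε.IsEven α} {q : L.CharClass p α}
    (hq : χ.toFun α hα = Sum.inr q) (x : L.grade α) :
    L.pDiff α hα x - (Quotient.out q).1.2 x ^ p • L.pDiff α hα (Quotient.out q).1.1
      ∈ normalIdeal (fun i => ¬ ε.IsEven (d i)) h := by
  have : Fact p.Prime := ⟨hp⟩
  refine apply_mem_of_basis ((normalIdeal (fun i => ¬ ε.IsEven (d i)) h).restrictScalars F) he
    (φ := fun x => L.pDiff α hα x
      - (Quotient.out q).1.2 x ^ p • L.pDiff α hα (Quotient.out q).1.1) ?_ ?_ ?_ x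
  · intro x y
    rw [L.pDiff_add hp hp2, map_add, add_pow_char, add_smul]
    abel
  · intro c x
    rw [L.pDiff_smul, map_smul, smul_eq_mul, mul_pow, smul_sub, smul_smul]
  · rintro ⟨_, _⟩ ⟨i, rfl, rfl⟩
    rw [Submodule.restrictScalars_mem]
    change L.pDiff (d i) hα ⟨e i, he i⟩ - (Quotient.out q).1.2 ⟨e i, he i⟩ ^ p •
      L.pDiff (d i) hα (Quotient.out q).1.1 ∈ _
    rcases (H i).eq_of_inr hq with ⟨h1, h2⟩ | ⟨h1, -⟩
    · rw [h1, zero_pow hp.ne_zero, zero_smul, sub_zero, ← h2]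
      exact mem_normalIdeal (not_not.2 hα)
    · rw [h1, (Quotient.out q).2, one_pow, one_smul, sub_self]
      exact zero_mem _

-- The point is that ξ occurs among the basis vectors. Otherwise c would vanish on all basis vectors
-- of degree α, and so on ξ, against c(ξ) = 1. The argument runs with the p-semilinear map c^p and
-- the zero subspace.
omit hp2 in
lemma pDiff_pow_sub_one_mem {α : Γ} {hα : ε.IsEven α} {q : L.CharClass p α}
    (hq : χ.toFun α hα = Sum.inr q) :
    L.pDiff α hα (Quotient.out q).1.1 ^ addOrderOf (p • α) - 1
      ∈ normalIdeal (fun i => ¬ ε.IsEven (d i)) h := by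
  have : Fact p.Prime := ⟨hp⟩
  by_contra hne
  have h0 := apply_mem_of_basis (p := p) (⊥ : Submodule F F) he
    (φ := fun x : L.grade α => (Quotient.out q).1.2 x ^ p) ?_ ?_ ?_ (Quotient.out q).1.1
  · rw [(Quotient.out q).2, one_pow, Submodule.mem_bot] at h0
    exact one_ne_zero h0
  · intro x y
    rw [map_add, add_pow_char]
  · intro c x
    rw [map_smul, smul_eq_mul, mul_pow, smul_eq_mul]
  · rintro ⟨_, _⟩ ⟨i, rfl, rfl⟩
    rw [Submodule.mem_bot]
    change (Quotient.out q).1.2 ⟨e i, he i⟩ ^ p = 0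
    rcases (H i).eq_of_inr hq with ⟨h1, -⟩ | ⟨h1, h2⟩
    · rw [h1, zero_pow hp.ne_zero]
    · rw [h1] at h2
      exact absurd (h2 ▸ mem_normalIdeal (not_not.2 hα)) hne

/-- The kernel of `U(𝔤) → u_χ(𝔤)` is generated by the normal elements of a homogeneous basis. -/
lemma quot_eq_zero_iff (a : L.Env) :
    χ.quot a = 0 ↔ a ∈ normalIdeal (fun i => ¬ ε.IsEven (d i)) h := by
  set I := normalIdeal (fun i => ¬ ε.IsEven (d i)) h with hI
  constructor
  · refine RingQuot.mem_of_mkAlgHom_eq_zero I ?_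
    -- `RedRel` imposes the relations of all representatives (η, b), the normal elements only those
    -- of the chosen (ξ, c). The two are compared through c = c(η) b and c(η)^s = 1.
    have key : ∀ {α : Γ} {hα : ε.IsEven α} {q : L.CharPair α},
        χ.toFun α hα = Sum.inr (Quotient.mk (L.charSetoid p α) q) → ∃ (ξ : L.grade α)
          (c : Dual F (L.grade α)), c = c q.1.1 • q.1.2 ∧ c q.1.1 ^ addOrderOf (p • α) = 1 ∧
          Ideal.Quotient.mkₐ F I (L.pDiff α hα ξ) ^ addOrderOf (p • α) = 1 ∧
          ∀ x, Ideal.Quotient.mkₐ F I (L.pDiff α hα x)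
            = c x ^ p • Ideal.Quotient.mkₐ F I (L.pDiff α hα ξ) := by
      intro α hα q hq
      set Q : L.CharClass p α := Quotient.mk (L.charSetoid p α) q with hQ
      obtain ⟨h1, -, h2, -⟩ := Quotient.exact (Quotient.out_eq Q)
      refine ⟨(Quotient.out Q).1.1, (Quotient.out Q).1.2, h1, h2, ?_, fun x => ?_⟩
      · have := pDiff_pow_sub_one_mem hp H hq
        rw [← hI, ← Ideal.Quotient.mk_eq_mk_iff_sub_mem] at this
        rw [← map_pow]
        exact this
      · have := pDiff_sub_mem_of_inr hp hp2 H hq x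
        rw [← hI, ← Ideal.Quotient.mk_eq_mk_iff_sub_mem] at this
        rw [← map_smul]
        exact this
    intro a b hab
    rw [← Ideal.Quotient.mk_eq_mk_iff_sub_mem]
    change Ideal.Quotient.mkₐ F I a = Ideal.Quotient.mkₐ F I b
    cases hab with
    | linear hl x =>
      exact Ideal.Quotient.eq.2 (pDiff_sub_mem_of_inl hp hp2 H hl x)
    | @root α hα q hq =>
      obtain ⟨ξ, c, -, h2, h3, h4⟩ := key hq
      -- Modulo the ideal η^p - η^[p] is c(η)^p times the element of ξ, so its s-th power is
      -- (c(η)^s)^p = 1.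
      rw [map_pow, map_one, h4, smul_pow, h3, ← pow_mul, mul_comm, pow_mul, h2, one_pow, one_smul]
    | @proportional α hα q hq x =>
      obtain ⟨ξ, c, h1, -, -, h4⟩ := key hq
      rw [map_smul, h4 x, h4 q.1.1, smul_smul, ← mul_pow]
      have := LinearMap.congr_fun h1 x
      rw [LinearMap.smul_apply, smul_eq_mul] at this
      rw [this, mul_comm]
  · intro ha
    rw [hI] at ha
    unfold normalIdeal at ha
    induction ha using Submodule.span_induction with
    | mem a ha =>
      obtain ⟨i, b, hi, rfl⟩ := ha
      rw [map_mul, (H i).quot_eq_zero hp.ne_zero (not_not.1 hi), zero_mul]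
    | zero => exact map_zero _
    | add a b _ _ ha hb => rw [map_add, ha, hb, add_zero]
    | smul c a _ ha => rw [smul_eq_mul, map_mul, ha, mul_zero]

lemma isNormalFamily : IsNormalFamily F (fun i => L.envι (e i)) (fun i => ¬ ε.IsEven (d i)) h N where
  pos i := (H i).pos hp.pos
  eq_two i hi := (H i).eq_two hi
  lead i := (H i).sub_pow_mem hp rfl
  mul_gen i hi j := by
    obtain ⟨δ, hδ⟩ := (H i).exists_mul_envι hp hp2 (not_not.1 hi)
    refine ⟨(ε δ (d j) : F)⁻¹, ?_⟩
    rw [hδ (he j), smul_smul, inv_mul_cancel₀ (Units.ne_zero _), one_smul]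
  mul_comm i hi j := by
    obtain ⟨δ, hδ⟩ := (H i).exists_mul_envι hp hp2 (not_not.1 hi)
    exact (H j).exists_mul_comm hp.ne_zero hδ

end Kernel

lemma PCharacter.exists_normalElement (χ : PCharacter L) {α : Γ} {x : L.grade α}
    (hx : ∀ (hα : ε.IsEven α) (q : L.CharClass p α), χ.toFun α hα = Sum.inr q →
      (Quotient.out q).1.2 x = 0 ∨ x = (Quotient.out q).1.1) :
    ∃ h N, χ.NormalElement α x h N := by
  by_cases hα : ε.IsEven α
  · rcases hc : χ.toFun α hα with l | q
    · exact ⟨_, _, .linear hα hc x⟩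
    · rcases hx hα q hc with h | rfl
      · exact ⟨_, _, .proportional hα hc h⟩
      · exact ⟨_, _, .root hα hc⟩
  · exact ⟨_, _, .odd hα x⟩

end Assembly
end LieColor

end

/-! ### The Frobenius form on u_χ(𝔤). -/

theorem theorem2p17 {F : Type*} [Field F] [IsAlgClosed F] (p : ℕ) [CharP F p]
    (hp : 3 < p)
    {Γ : Type*} [AddCommGroup Γ] [DecidableEq Γ] (ε : LieColor.Bicharacter Γ F)
    {𝔤 : Type*} [AddCommGroup 𝔤] [Module F 𝔤] [FiniteDimensional F 𝔤]
    (L : LieColor.RestrictedLieColorAlgebra p ε 𝔤) (χ : LieColor.PCharacter L) :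
    LieColor.IsFrobenius χ.grade := by
  have hprime : p.Prime := (CharP.char_is_prime_or_zero F p).resolve_right (by omega)
  have hsmall : ∀ k : ℕ, 0 < k → k < p → (k : F) ≠ 0 := fun k hk hkp => by
    rw [Ne, CharP.cast_eq_zero_iff F p]
    exact Nat.not_dvd_of_pos_of_lt hk hkp
  have h2 : (2 : F) ≠ 0 := mod_cast hsmall 2 (by omega) (by omega)
  have h3 : (3 : F) ≠ 0 := mod_cast hsmall 3 (by omega) hp
  have hp2 : p ≠ 2 := by omega
  obtain ⟨n, e, d, he, hadapt⟩ := χ.exists_adapted_basis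
  choose h N H using fun i => χ.exists_normalElement (x := ⟨e i, he i⟩) (hadapt i)
  obtain ⟨f, hf, hinv⟩ := (LieColor.isNormalFamily hprime hp2 H).exists_nondegenerate_form
    (LieColor.isPBWAlgebra_env h2 h3 he) χ.quot (RingQuot.mkAlgHom_surjective F _)
    (LieColor.quot_eq_zero_iff hprime hp2 H)
  exact ⟨f, hf, fun _ _ _ x y z _ _ _ => hinv x y z⟩
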